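/- **Comparison Lemma.** Let $n\ge 1$ be an integer. For $r>t\ge 0$ and functions $f$ on $(0,\infty)$ let $$[Lf](r,t)=\frac{1}{2r^{(n-1)/2}}\int_{r-t}^{r+t}\lambda^{(n-1)/2}f(\lambda)\,K_n\big(z(\lambda,r,t)\big)\,d\lambda,\qquad z(\lambda,r,t)=\frac{\lambda^2+r^2-t^2}{2r\lambda},$$ be the Riemann operator of the radial wave equation. Here $K_n=P_{(n-3)/2}$ is a Legendre polynomial for odd $n$ (with $P_{-1}=1$), and for even $n$, with $m=(n-2)/2$ and $T_m$ the $m$th Chebyshev polynomial, $$K_n(z)=\frac{\sqrt2}{\pi}\int_{\max(z,-1)}^1\frac{1}{\sqrt{\sigma-z}}\,\frac{T_m(\sigma)}{\sqrt{1-\sigma^2}}\,d\sigma .$$ Let $[\mathscr LG](r,t)=\int_0^t[LG(\cdot,\tau)](r,t-\tau)\,d\tau$ be the Duhamel operator. For $R>0$ and $0<T\le\infty$ put $\Theta_T=\{(r,t): r>t+R,\ 0\le t<T\}$. Given $g\colon(R,\infty)\times\mathbb R\to\mathbb R$ and $\psi\colon(R,\infty)\to\mathbb R$, consider the exterior problem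 $$\partial_t^2u-\partial_r^2u-\frac{n-1}{r}\,\partial_ru=g(r,u)\ \text{ in }\Theta_T,\qquad u(r,0)=0,\quad \partial_tu(r,0)=\psi(r)\ \text{ on }(R,\infty).\tag{$*$}$$ A *solution* of $(*)$ in $\Theta_T$ is a continuous, locally bounded function $u$ on $\Theta_T$ of locally finite energy, that is, $r^{(n-1)/2}(|u|+|\partial_ru|+|\partial_tu|)\in L^2_{\rm loc}(\Theta_T)$ with weak derivatives $\partial_ru,\partial_tu$, such that $u(r,0)=0$ for $r>R$ and $$\int_{\Theta_T}u\Big(\partial_t^2\varphi-\partial_r^2\varphi-\frac{n-1}{r}\,\partial_r\varphi\Big)r^{n-1}\,dr\,dt=\int_{\Theta_T}g(r,u)\,\varphi\,r^{n-1}\,dr\,dt+\int_R^\infty\psi(r)\,\varphi(r,0)\,r^{n-1}\,dr$$ for every $\varphi\in C_c^\infty(\mathbb R^2)$ with $\operatorname{supp}\varphi\cap\{t\ge0\}\subset\Theta_T$. There is a constant $\beta_n>1$, depending only on $n$, for which both of the following hold. 1. *(Positivity.)* Let $R>0$, $t\ge0$ and $r>\max(\beta_nt,\,t+R)$. If $f$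 is continuous and non-negative on $(R,\infty)$, then $[Lf](r,t)\ge0$. If $G\colon\mathbb R^2\to\mathbb R$ is continuous and $G(\lambda,\tau)\ge0$ whenever $0\le\tau\le t$ and $\lambda>\max(\beta_n\tau,\tau+R)$, then $[\mathscr LG](r,t)\ge0$. 2. *(Comparison.)* Let $R>0$. Let $g\colon(R,\infty)\times\mathbb R\to\mathbb R$ be $C^1$ with $g(r,0)=0$ for $r>R$ and $\partial_ug(r,u)\ge0$ on $(R,\infty)\times[0,\infty)$. Let $\psi,\widetilde\psi\colon(R,\infty)\to\mathbb R$ be continuous with $\psi\ge\widetilde\psi\ge0$. If $u$ is a solution of $(*)$ in $\Theta_T$ with datum $\psi$, and $\widetilde u$ is a solution in $\Theta_{\widetilde T}$ with datum $\widetilde\psi$, then $$u(r,t)\ge\widetilde u(r,t)\ge0\qquad\text{whenever } r>\max(\beta_nt,\,t+R)\ \text{ and }\ 0\le t<\min(T,\widetilde T).$$ -/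

import Mathlib

open MeasureTheory Set
open scoped ContDiff

noncomputable section

namespace RadialWave

/-! The radial wave equation in space dimension `n`; a point of the `(r, t)` half plane is a pair
`p : ℝ × ℝ` with `p.1 = r` and `p.2 = t`. -/

/-! ### The Riemann operator and the Duhamel operator -/

/-- The `m`th Legendre polynomial `P_m(z)`, obtained from the shifted Legendre polynomial
`x ↦ P_m(1 - 2x)`. -/
def legendreP (m : ℕ) (z : ℝ) : ℝ :=
  Polynomial.aeval ((1 - z) / 2) (Polynomial.shiftedLegendre m)

/-- `U_m(z) = (√2 / π) ∫_{max(z,-1)}^1 T_m(σ) / (√(σ - z) √(1 - σ²)) dσ`, where `T_m` is the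
`m`th Chebyshev polynomial. -/
def kernelU (m : ℕ) (z : ℝ) : ℝ :=
  Real.sqrt 2 / Real.pi *
    ∫ σ in (max z (-1))..1,
      1 / Real.sqrt (σ - z) *
        ((Polynomial.Chebyshev.T ℝ (m : ℤ)).eval σ / Real.sqrt (1 - σ ^ 2))

/-- `z(l, r, t) = (l² + r² - t²) / (2 r l)`. -/
def zFun (l r t : ℝ) : ℝ := (l ^ 2 + r ^ 2 - t ^ 2) / (2 * r * l)

open Classical in
/-- The Riemann operator `L` of the radial wave equation in dimension `n`.

For odd `n` the kernel is `P_m(z)` with `m = (n - 3) / 2`; when `n = 1` the truncated subtraction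
gives `P_0 = 1`, in accordance with the usual convention `P_{-1} = P_0` (d'Alembert's formula).
For even `n` the kernel is `U_m(z)` with `m = (n - 2) / 2`. -/
def riemannL (n : ℕ) (f : ℝ → ℝ) (r t : ℝ) : ℝ :=
  if Odd n then
    1 / (2 * r ^ (((n : ℝ) - 1) / 2)) *
      ∫ l in |t - r|..(t + r),
        l ^ (((n : ℝ) - 1) / 2) * f l * legendreP ((n - 3) / 2) (zFun l r t)
  else
    1 / (2 * r ^ (((n : ℝ) - 1) / 2)) *
        (∫ l in |t - r|..(t + r),
          l ^ (((n : ℝ) - 1) / 2) * f l * kernelU ((n - 2) / 2) (zFun l r t)) +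
      1 / (2 * r ^ (((n : ℝ) - 1) / 2)) *
        ∫ l in (0 : ℝ)..(max (t - r) 0),
          l ^ (((n : ℝ) - 1) / 2) * f l * kernelU ((n - 2) / 2) (zFun l r t)

/-- The Duhamel operator `[𝓛 G](r, t) = ∫₀ᵗ [L G(·, τ)](r, t - τ) dτ`. -/
def duhamel (n : ℕ) (G : ℝ × ℝ → ℝ) (r t : ℝ) : ℝ :=
  ∫ τ in (0 : ℝ)..t, riemannL n (fun l => G (l, τ)) r (t - τ)

/-- The constant `β` makes the Riemann operator and the Duhamel operator positive in the regions
`r > max (β t) (t + R)`, for every `R > 0`. -/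
def PositivityConstant (n : ℕ) (β : ℝ) : Prop :=
  ∀ R : ℝ, 0 < R →
    (∀ f : ℝ → ℝ, ContinuousOn f (Ioi R) → (∀ x ∈ Ioi R, 0 ≤ f x) →
      ∀ r t : ℝ, 0 ≤ t → max (β * t) (t + R) < r → 0 ≤ riemannL n f r t) ∧
    (∀ G : ℝ × ℝ → ℝ, Continuous G → ∀ r t : ℝ, 0 ≤ t → max (β * t) (t + R) < r →
      (∀ l τ : ℝ, 0 ≤ τ → τ ≤ t → max (β * τ) (τ + R) < l → 0 ≤ G (l, τ)) →
      0 ≤ duhamel n G r t)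

/-! ### Solutions of the exterior problem -/

/-- The region `Θ_T = {(r, t) : r > t + R, 0 ≤ t < T}`; the lifespan `T` may be infinite.
It contains its initial line `t = 0`. -/
def Theta (R : ℝ) (T : EReal) : Set (ℝ × ℝ) :=
  {p | p.2 + R < p.1 ∧ 0 ≤ p.2 ∧ (p.2 : EReal) < T}

/-- The radial d'Alembertian `φ_tt - φ_rr - ((n - 1) / r) φ_r` of a (smooth) function. -/
def radialBox (n : ℕ) (φ : ℝ × ℝ → ℝ) (p : ℝ × ℝ) : ℝ :=
  iteratedDeriv 2 (fun t => φ (p.1, t)) p.2 - iteratedDeriv 2 (fun r => φ (r, p.2)) p.1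
    - ((n : ℝ) - 1) / p.1 * deriv (fun r => φ (r, p.2)) p.1

/-- `w = ∂_r u` in the sense of distributions in the interior of `Θ_T`. -/
def IsWeakDerivR (R : ℝ) (T : EReal) (u w : ℝ × ℝ → ℝ) : Prop :=
  ∀ φ : ℝ × ℝ → ℝ, ContDiff ℝ ∞ φ → HasCompactSupport φ →
    tsupport φ ⊆ Theta R T ∩ {p | 0 < p.2} →
    ∫ p in Theta R T, u p * deriv (fun r => φ (r, p.2)) p.1 = - ∫ p in Theta R T, w p * φ p

/-- `w = ∂_t u` in the sense of distributions in the interior of `Θ_T`. -/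
def IsWeakDerivT (R : ℝ) (T : EReal) (u w : ℝ × ℝ → ℝ) : Prop :=
  ∀ φ : ℝ × ℝ → ℝ, ContDiff ℝ ∞ φ → HasCompactSupport φ →
    tsupport φ ⊆ Theta R T ∩ {p | 0 < p.2} →
    ∫ p in Theta R T, u p * deriv (fun t => φ (p.1, t)) p.2 = - ∫ p in Theta R T, w p * φ p

/-- `r^((n-1)/2) v ∈ L²_loc(Θ_T)`. -/
def LocallyL2 (n : ℕ) (R : ℝ) (T : EReal) (v : ℝ × ℝ → ℝ) : Prop :=
  ∀ K : Set (ℝ × ℝ), IsCompact K → K ⊆ Theta R T →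
    MemLp (fun p : ℝ × ℝ => p.1 ^ (((n : ℝ) - 1) / 2) * v p) 2 (volume.restrict K)

/-- `u` is a solution of the exterior problem
`u_tt - u_rr - ((n - 1) / r) u_r = g(r, u)` in `Θ_T`, `u(r, 0) = 0`, `u_t(r, 0) = ψ(r)` on `(R, ∞)`
which is continuous, locally bounded and of locally finite energy in `Θ_T`.

The equation and the condition `u_t(r, 0) = ψ(r)` hold in the sense of distributions: one
multiplies by `r^(n-1) φ` and integrates by parts over `Θ_T`, where the support of the test
function `φ` may meet the initial line `t = 0`, but no other part of the boundary. -/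
structure IsSolution (n : ℕ) (R : ℝ) (T : EReal) (g : ℝ → ℝ → ℝ) (ψ : ℝ → ℝ)
    (u : ℝ × ℝ → ℝ) : Prop where
  continuousOn : ContinuousOn u (Theta R T)
  locallyBounded : ∀ K : Set (ℝ × ℝ), IsCompact K → K ⊆ Theta R T → ∃ C : ℝ, ∀ p ∈ K, |u p| ≤ C
  finiteEnergy : ∃ ur ut : ℝ × ℝ → ℝ, IsWeakDerivR R T u ur ∧ IsWeakDerivT R T u ut ∧
    LocallyL2 n R T u ∧ LocallyL2 n R T ur ∧ LocallyL2 n R T ut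
  initial : ∀ r : ℝ, (r, (0 : ℝ)) ∈ Theta R T → u (r, 0) = 0
  equation : ∀ φ : ℝ × ℝ → ℝ, ContDiff ℝ ∞ φ → HasCompactSupport φ →
    tsupport φ ∩ {p | 0 ≤ p.2} ⊆ Theta R T →
    ∫ p in Theta R T, u p * radialBox n φ p * p.1 ^ (n - 1) =
      (∫ p in Theta R T, g p.1 (u p) * φ p * p.1 ^ (n - 1)) +
        ∫ r in Ioi R, ψ r * φ (r, 0) * r ^ (n - 1)

end RadialWave

end

/-!
Write `k = (n - 1) / 2` and `c = k (k - 1)`. If `u` solves the radial wave equation then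
`v = r ^ k * u` solves `v_tt - v_rr + c / r² v = r ^ k * g(r, u)`, a one-dimensional wave equation
with a potential. The comparison uses this form and not the representation of `u` by the operators
`L` and `𝓛`.

Positivity of `L` and `𝓛`: on the domain of integration `1 - z ≤ t² / (2 r (r - t))`, so that for
`r > β t` with `β` large only values of the kernel near `z = 1` enter. These are non-negative, since
`P_m(1) = T_m(1) = 1` (`exists_positivityConstant`).

Comparison: testing the weak equation with smooth approximations of `r ^ (-k)` times the indicator
function of a backward cone shows that `v` satisfies d'Alembert's formula, in which the potential is
a part of the source (`IsSolution.dAlembert`). These approximations are products of functions of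
`r + t` and `r - t`, so that `∂_t² - ∂_r²` maps them to an approximate identity at the apex.

The difference `w` of two such functions then satisfies `w = W - S (c / r² w)`, where `S` is half
the integral over backward triangles. If `F ≥ 0` then `S F` increases when the triangle grows, hence
`S (c / r² S F) ≤ θ S F` with `θ ≤ sup (c t² / (r - t)²)`. For `r > β t` and `β` large, `θ ≤ 1`, and
the wrong sign of the potential for `c > 0` is harmless (for `c ≤ 0` it is a good one): inserting
the equation once into itself gives `w ≥ (1 - θ) W⁺ - W⁻ - S (c / r² S (c / r² w⁻))`. As `g(r, ·)`
is increasing on `[0, ∞)` and locally Lipschitz, `W⁻` is bounded by a multiple of `S w⁻`, and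
Gronwall's argument yields `w⁻ = 0` (`nonneg_of_integral_equation`). This is applied first to `u₂`
and `0`, then to `u₁` and `u₂`.
-/

namespace RadialWave

/-! ### Positivity of the Riemann and Duhamel operators -/

lemma continuous_legendreP (m : ℕ) : Continuous (legendreP m) := by
  unfold legendreP
  simp only [Polynomial.aeval_def, Polynomial.eval₂_eq_eval_map]
  fun_prop

lemma legendreP_one (m : ℕ) : legendreP m 1 = 1 := by
  simp [legendreP, Polynomial.aeval_def, Polynomial.eval₂_at_zero,
    Polynomial.coeff_shiftedLegendre]

lemma exists_legendreP_nonneg (m : ℕ) :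
    ∃ δ > 0, ∀ z : ℝ, 1 - δ ≤ z → z ≤ 1 → 0 ≤ legendreP m z := by
  have h : ∀ᶠ z in nhds (1 : ℝ), 0 < legendreP m z :=
    (continuous_legendreP m).continuousAt.eventually_const_lt (by simp [legendreP_one])
  obtain ⟨ε, hε, h⟩ := Metric.eventually_nhds_iff.1 h
  refine ⟨ε / 2, by positivity, fun z hz hz' => (h ?_).le⟩
  rw [Real.dist_eq, abs_lt]
  constructor <;> linarith

lemma exists_kernelU_nonneg (m : ℕ) :
    ∃ δ > 0, ∀ z : ℝ, 1 - δ ≤ z → z ≤ 1 → 0 ≤ kernelU m z := by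
  have h : ∀ᶠ z in nhds (1 : ℝ), 0 < (Polynomial.Chebyshev.T ℝ (m : ℤ)).eval z :=
    (Polynomial.continuous _).continuousAt.eventually_const_lt (by simp)
  obtain ⟨ε, hε, h⟩ := Metric.eventually_nhds_iff.1 h
  refine ⟨min (ε / 2) 1, by positivity, fun z hz hz' => ?_⟩
  have h1 := min_le_left (ε / 2) 1
  have h2 := min_le_right (ε / 2) 1
  unfold kernelU
  refine mul_nonneg (by positivity) (intervalIntegral.integral_nonneg ?_ fun σ hσ => ?_)
  · exact max_le hz' (by norm_num)
  · have h3 := (le_max_left _ _).trans hσ.1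
    have : 0 < (Polynomial.Chebyshev.T ℝ (m : ℤ)).eval σ := by
      refine h ?_
      rw [Real.dist_eq, abs_lt]
      constructor <;> linarith [hσ.2]
    positivity

/-- On the domain of integration, `0 ≤ 1 - z ≤ t² / (2 r (r - t))`, which is small for
`r ≥ β t` with `β` large. -/
lemma zFun_mem {δ β l r t : ℝ} (hδ : 0 < δ) (hβ : 2 + 1 / δ ≤ β) (ht : 0 ≤ t) (hr : β * t < r)
    (hl : r - t ≤ l) (hl' : l ≤ r + t) : 1 - δ ≤ zFun l r t ∧ zFun l r t ≤ 1 := by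
  have hδ' : 0 < 1 / δ := by positivity
  have h2 : 2 ≤ β := by linarith
  have h1 : 2 * t ≤ r := by nlinarith
  have hr0 : 0 < r := by nlinarith
  have hl0 : 0 < l := by nlinarith
  unfold zFun
  refine ⟨?_, ?_⟩
  · rw [le_div_iff₀ (by positivity)]
    have h3 : 1 ≤ δ * (β - 2) := by
      have := mul_le_mul_of_nonneg_left hβ hδ.le
      rw [mul_add, mul_one_div_cancel hδ.ne'] at this
      linarith
    -- `r (r - t) δ ≥ (β t) t δ ≥ t²`
    have h4 : t ^ 2 ≤ δ * (r * l) := by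
      have h5 : β * t * t ≤ r * l := by
        apply mul_le_mul hr.le _ ht hr0.le
        linarith
      have h6 : t ^ 2 * 1 ≤ t ^ 2 * (δ * β) :=
        mul_le_mul_of_nonneg_left (by nlinarith) (by positivity)
      nlinarith
    nlinarith [sq_nonneg (l - r)]
  · rw [div_le_one (by positivity)]
    nlinarith

lemma riemannL_nonneg {n : ℕ} {δ β : ℝ} (hδ : 0 < δ)
    (hP : ∀ z : ℝ, 1 - δ ≤ z → z ≤ 1 → 0 ≤ legendreP ((n - 3) / 2) z)
    (hU : ∀ z : ℝ, 1 - δ ≤ z → z ≤ 1 → 0 ≤ kernelU ((n - 2) / 2) z)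
    (hβ : 2 + 1 / δ ≤ β) {r t : ℝ} (ht : 0 ≤ t) (hr : β * t < r) {f : ℝ → ℝ}
    (hf : ∀ l, r - t ≤ l → l ≤ r + t → 0 ≤ f l) : 0 ≤ riemannL n f r t := by
  have hδ' : 0 < 1 / δ := by positivity
  have h1 : 2 * t ≤ r := by nlinarith
  have hr0 : 0 < r := by nlinarith
  have habs : |t - r| = r - t := by rw [abs_of_nonpos (by linarith)]; ring
  have hmax : max (t - r) 0 = 0 := max_eq_right (by linarith)
  have hpos : ∀ K : ℝ → ℝ, (∀ z : ℝ, 1 - δ ≤ z → z ≤ 1 → 0 ≤ K z) →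
      0 ≤ ∫ l in (r - t)..(t + r), l ^ (((n : ℝ) - 1) / 2) * f l * K (zFun l r t) := by
    intro K hK
    refine intervalIntegral.integral_nonneg (by linarith) fun l hl => ?_
    obtain ⟨hz, hz'⟩ := zFun_mem hδ hβ ht hr hl.1 (by linarith [hl.2])
    have hl0 : 0 ≤ l := by linarith [hl.1]
    exact mul_nonneg (mul_nonneg (Real.rpow_nonneg hl0 _) (hf l hl.1 (by linarith [hl.2])))
      (hK _ hz hz')
  unfold riemannL
  rw [habs, hmax, intervalIntegral.integral_same, mul_zero, add_zero]
  split_ifs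
  · exact mul_nonneg (by positivity) (hpos _ hP)
  · exact mul_nonneg (by positivity) (hpos _ hU)

/-- In the backward triangle of a point of the region `r > max (β t) (t + R)` one stays in that
region. -/
lemma region_of_backward {R β r t l τ : ℝ} (hβ : 1 < β) (hr : max (β * t) (t + R) < r)
    (hτt : τ ≤ t) (hl : r - t ≤ l - τ) : max (β * τ) (τ + R) < l := by
  obtain ⟨h1, h2⟩ := max_lt_iff.1 hr
  exact max_lt (by nlinarith) (by linarith)

lemma exists_positivityConstant (n : ℕ) : ∃ β₀ : ℝ, 2 ≤ β₀ ∧ ∀ β ≥ β₀, PositivityConstant n β := by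
  obtain ⟨δ₁, hδ₁, hP⟩ := exists_legendreP_nonneg ((n - 3) / 2)
  obtain ⟨δ₂, hδ₂, hU⟩ := exists_kernelU_nonneg ((n - 2) / 2)
  have hδ : 0 < min δ₁ δ₂ := lt_min hδ₁ hδ₂
  have hδ' : 0 < 1 / min δ₁ δ₂ := by positivity
  refine ⟨2 + 1 / min δ₁ δ₂, by linarith, fun β hβ R hR => ?_⟩
  have key : ∀ {r t : ℝ}, 0 ≤ t → β * t < r → ∀ {f : ℝ → ℝ},
      (∀ l, r - t ≤ l → l ≤ r + t → 0 ≤ f l) → 0 ≤ riemannL n f r t := fun ht hr _ hf =>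
    riemannL_nonneg hδ (fun z hz hz' => hP z (by linarith [min_le_left δ₁ δ₂]) hz')
      (fun z hz hz' => hU z (by linarith [min_le_right δ₁ δ₂]) hz') hβ ht hr hf
  refine ⟨fun f _ hf r t ht hr => ?_, fun G _ r t ht hr hG => ?_⟩
  · obtain ⟨h1, h2⟩ := max_lt_iff.1 hr
    exact key ht h1 fun l hl _ => hf l (show R < l by linarith)
  · refine intervalIntegral.integral_nonneg ht fun τ hτ => ?_
    obtain ⟨h1, h2⟩ := max_lt_iff.1 hr
    refine key (by linarith [hτ.2]) (by nlinarith [hτ.1]) fun l hl _ => ?_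
    exact hG l τ hτ.1 hτ.2 (region_of_backward (by linarith) hr hτ.2 (by linarith))

/-! ### Backward triangles -/

/-- The domain of dependence of the point `p` in `t ≥ 0`, without its two characteristic sides:
in this form it is the pointwise limit of the supports of the test functions used below. -/
def backwardTriangle (p : ℝ × ℝ) : Set (ℝ × ℝ) :=
  {q | 0 ≤ q.2 ∧ q.1 + q.2 < p.1 + p.2 ∧ p.1 - p.2 < q.1 - q.2}

/-- The domain of dependence of the point `p` in `t ≥ 0`, a compact triangle. -/
def closedTriangle (p : ℝ × ℝ) : Set (ℝ × ℝ) :=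
  {q | 0 ≤ q.2 ∧ q.1 + q.2 ≤ p.1 + p.2 ∧ p.1 - p.2 ≤ q.1 - q.2}

lemma backwardTriangle_subset_closedTriangle (p : ℝ × ℝ) :
    backwardTriangle p ⊆ closedTriangle p := fun _ h => ⟨h.1, h.2.1.le, h.2.2.le⟩

lemma backwardTriangle_mono {p q : ℝ × ℝ} (h : q ∈ closedTriangle p) :
    backwardTriangle q ⊆ backwardTriangle p := fun _ hx =>
  ⟨hx.1, hx.2.1.trans_le h.2.1, h.2.2.trans_lt hx.2.2⟩

lemma closedTriangle_mono {p q : ℝ × ℝ} (h : q ∈ closedTriangle p) :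
    closedTriangle q ⊆ closedTriangle p := fun _ hx =>
  ⟨hx.1, hx.2.1.trans h.2.1, h.2.2.trans hx.2.2⟩

lemma snd_le_of_mem_closedTriangle {p q : ℝ × ℝ} (h : q ∈ closedTriangle p) : q.2 ≤ p.2 := by
  obtain ⟨-, h1, h2⟩ := h
  linarith

lemma measurableSet_backwardTriangle (p : ℝ × ℝ) : MeasurableSet (backwardTriangle p) :=
  (measurableSet_le measurable_const measurable_snd).inter
    ((measurableSet_lt (measurable_fst.add measurable_snd) measurable_const).inter
      (measurableSet_lt measurable_const (measurable_fst.sub measurable_snd)))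

lemma isClosed_closedTriangle (p : ℝ × ℝ) : IsClosed (closedTriangle p) :=
  (isClosed_le continuous_const continuous_snd).inter
    ((isClosed_le (continuous_fst.add continuous_snd) continuous_const).inter
      (isClosed_le continuous_const (continuous_fst.sub continuous_snd)))

lemma closedTriangle_subset_prod (p : ℝ × ℝ) :
    closedTriangle p ⊆ Icc (p.1 - p.2) (p.1 + p.2) ×ˢ Icc 0 p.2 := by
  rintro q ⟨h0, h1, h2⟩
  refine ⟨⟨?_, ?_⟩, ⟨h0, ?_⟩⟩ <;> linarith

lemma isCompact_closedTriangle (p : ℝ × ℝ) : IsCompact (closedTriangle p) :=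
  (isCompact_Icc.prod isCompact_Icc).of_isClosed_subset (isClosed_closedTriangle p)
    (closedTriangle_subset_prod p)

lemma integrableOn_backwardTriangle {p : ℝ × ℝ} {f : ℝ × ℝ → ℝ}
    (hf : ContinuousOn f (closedTriangle p)) : IntegrableOn f (backwardTriangle p) :=
  (hf.integrableOn_compact (isCompact_closedTriangle p)).mono_set
    (backwardTriangle_subset_closedTriangle p)

lemma setIntegral_backwardTriangle_le_prod {p : ℝ × ℝ} {f g : ℝ → ℝ} (hf : Continuous f)
    (hg : Continuous g) (hf0 : ∀ x, 0 ≤ f x) (hg0 : ∀ x, 0 ≤ g x) :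
    ∫ q in backwardTriangle p, f q.1 * g q.2 ≤
      (∫ x in Icc (p.1 - p.2) (p.1 + p.2), f x) * ∫ s in Icc 0 p.2, g s := by
  rw [← setIntegral_prod_mul, ← Measure.volume_eq_prod]
  refine setIntegral_mono_set ?_ ?_ (Filter.Eventually.of_forall
    ((backwardTriangle_subset_closedTriangle p).trans (closedTriangle_subset_prod p)))
  · exact ContinuousOn.integrableOn_compact (isCompact_Icc.prod isCompact_Icc) (by fun_prop)
  · exact Filter.Eventually.of_forall fun q => mul_nonneg (hf0 _) (hg0 _)

lemma setIntegral_backwardTriangle_exp_le {p : ℝ × ℝ} (hp : 0 ≤ p.2) {a : ℝ} (ha : 0 < a) :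
    1 / 2 * ∫ q in backwardTriangle p, Real.exp (a * q.2) ≤ p.2 / a * Real.exp (a * p.2) := by
  have h := setIntegral_backwardTriangle_le_prod (p := p) (f := fun _ => 1)
    (g := fun s => Real.exp (a * s)) continuous_const (by fun_prop) (fun _ => zero_le_one)
    (fun _ => (Real.exp_pos _).le)
  simp only [one_mul] at h
  have h1 : ∫ _x in Icc (p.1 - p.2) (p.1 + p.2), (1 : ℝ) = 2 * p.2 := by
    simp [hp]
    ring
  have h2 : ∫ s in Icc 0 p.2, Real.exp (a * s) = (Real.exp (a * p.2) - 1) / a := by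
    rw [integral_Icc_eq_integral_Ioc, ← intervalIntegral.integral_of_le hp,
      intervalIntegral.integral_comp_mul_left (fun x => Real.exp x) ha.ne', integral_exp]
    simp [div_eq_inv_mul]
  rw [h1, h2] at h
  have h3 : 2 * p.2 * ((Real.exp (a * p.2) - 1) / a) ≤ 2 * (p.2 / a * Real.exp (a * p.2)) := by
    rw [mul_div_assoc', div_mul_eq_mul_div, mul_div_assoc']
    refine div_le_div_of_nonneg_right ?_ ha.le
    nlinarith
  linarith

/-! ### A comparison principle for the integrated equation -/

/-- Let `w` solve `w_tt - w_rr + V w = F` with `w = 0` and `w_t = Ψ ≥ 0` at `t = 0`, in the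
integrated form of d'Alembert. A potential `V ≥ 0` works against positivity, but if it is small on
the triangle in the sense of `hsmall` then `w ≥ 0`, as soon as the negative part of `F` is
controlled by that of `w`.

The integral equation is used twice. Let `N e^{a t}` be the smallest such bound of the negative
part of `w`, attained at `p`. Once, the equation bounds `w` above by `P + O(N e^{a t} / a)`, where
`P ≥ 0` is the contribution of `Ψ` and `F⁺` at `p`, which exceeds that at all points before `p`.
Inserting this into the equation at `p` yields `w p ≥ P - P - O(N e^{a t} / a)`, which forces
`N = 0` for large `a`. -/
theorem nonneg_of_integral_equation {p₀ : ℝ × ℝ} {w V F : ℝ × ℝ → ℝ}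
    {Ψ : ℝ → ℝ} {C : ℝ}
    (hw : ContinuousOn w (closedTriangle p₀)) (hV : ContinuousOn V (closedTriangle p₀))
    (hF : ContinuousOn F (closedTriangle p₀))
    (hΨ : IntegrableOn Ψ (Ioo (p₀.1 - p₀.2) (p₀.1 + p₀.2)))
    (hΨ0 : ∀ x ∈ Ioo (p₀.1 - p₀.2) (p₀.1 + p₀.2), 0 ≤ Ψ x)
    (hV0 : ∀ q ∈ closedTriangle p₀, 0 ≤ V q)
    (hsmall : ∀ q ∈ closedTriangle p₀, 1 / 2 * ∫ x in backwardTriangle q, V x ≤ 1)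
    (hC : 0 ≤ C) (hFw : ∀ q ∈ closedTriangle p₀, -(C * max (-w q) 0) ≤ F q)
    (heq : ∀ q ∈ closedTriangle p₀, w q = 1 / 2 * (∫ x in Ioo (q.1 - q.2) (q.1 + q.2), Ψ x) +
      1 / 2 * ∫ x in backwardTriangle q, (F x - V x * w x)) :
    ∀ q ∈ closedTriangle p₀, 0 ≤ w q := by
  intro q₁ hq₁
  have hcpt := isCompact_closedTriangle p₀
  have hL0 : 0 ≤ p₀.2 := hq₁.1.trans (snd_le_of_mem_closedTriangle hq₁)
  set L := p₀.2 with hL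
  obtain ⟨B₀, hB₀⟩ := hcpt.exists_bound_of_continuousOn hV
  set B := max B₀ 0
  have hB0 : 0 ≤ B := le_max_right _ _
  have hB : ∀ q ∈ closedTriangle p₀, V q ≤ B := fun q hq =>
    (le_abs_self _).trans ((hB₀ q hq).trans (le_max_left _ _))
  -- The rate is chosen so that `(C + B² L / a) L / a < 1`.
  set a := 1 + L * (C + B ^ 2 * L) with ha
  have ha1 : 1 ≤ a := by
    have : 0 ≤ L * (C + B ^ 2 * L) := by positivity
    linarith
  have ha0 : 0 < a := by linarith
  have hexp : ∀ q ∈ closedTriangle p₀,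
      1 / 2 * ∫ x in backwardTriangle q, Real.exp (a * x.2) ≤ L / a * Real.exp (a * q.2) := by
    intro q hq
    refine (setIntegral_backwardTriangle_exp_le hq.1 ha0).trans ?_
    have := snd_le_of_mem_closedTriangle hq
    gcongr
  obtain ⟨p, hp, hmax⟩ := hcpt.exists_isMaxOn ⟨q₁, hq₁⟩
    (f := fun q => Real.exp (-(a * q.2)) * max (-w q) 0) (by fun_prop)
  set N := Real.exp (-(a * p.2)) * max (-w p) 0 with hN
  have hN0 : 0 ≤ N := by positivity
  have hwN : ∀ q ∈ closedTriangle p₀, max (-w q) 0 ≤ N * Real.exp (a * q.2) := by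
    intro q hq
    have h := hmax hq
    simp only [mem_ofPred_eq] at h
    rw [Real.exp_neg, inv_mul_le_iff₀ (Real.exp_pos _)] at h
    linarith
  have hpN : max (-w p) 0 = N * Real.exp (a * p.2) := by
    rw [hN, Real.exp_neg]
    field_simp
  suffices hN' : N ≤ 0 by
    have h1 := hwN q₁ hq₁
    have h2 : N = 0 := le_antisymm hN' hN0
    rw [h2, zero_mul] at h1
    linarith [le_max_left (-w q₁) 0]
  by_contra! hNpos
  have hwp : w p = -(N * Real.exp (a * p.2)) := by
    have h : 0 < max (-w p) 0 := by rw [hpN]; positivity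
    rcases le_total (-w p) 0 with h' | h'
    · rw [max_eq_right h'] at h
      exact absurd h (lt_irrefl _)
    · rw [max_eq_left h'] at hpN
      linarith
  have hFp : ContinuousOn (fun q => max (F q) 0) (closedTriangle p₀) := by fun_prop
  have hFVw : ContinuousOn (fun q => F q - V q * w q) (closedTriangle p₀) := by fun_prop
  have hint : ∀ {f : ℝ × ℝ → ℝ}, ContinuousOn f (closedTriangle p₀) →
      ∀ q ∈ closedTriangle p₀, IntegrableOn f (backwardTriangle q) := fun hf q hq =>
    integrableOn_backwardTriangle (hf.mono (closedTriangle_mono hq))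
  have hE : ContinuousOn (fun q : ℝ × ℝ => Real.exp (a * q.2)) (closedTriangle p₀) := by fun_prop
  set P := 1 / 2 * (∫ x in Ioo (p.1 - p.2) (p.1 + p.2), Ψ x) +
    1 / 2 * ∫ x in backwardTriangle p, max (F x) 0 with hP
  have hIoo : Ioo (p.1 - p.2) (p.1 + p.2) ⊆ Ioo (p₀.1 - p₀.2) (p₀.1 + p₀.2) :=
    Ioo_subset_Ioo hp.2.2 hp.2.1
  have hP0 : 0 ≤ P := by
    have h1 : 0 ≤ ∫ x in Ioo (p.1 - p.2) (p.1 + p.2), Ψ x :=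
      setIntegral_nonneg measurableSet_Ioo fun x hx => hΨ0 x (hIoo hx)
    have h2 : 0 ≤ ∫ x in backwardTriangle p, max (F x) 0 :=
      setIntegral_nonneg (measurableSet_backwardTriangle p) fun x _ => le_max_right _ _
    positivity
  have hupper : ∀ q ∈ closedTriangle p, w q ≤ P + B * N * (L / a) * Real.exp (a * q.2) := by
    intro q hq
    have hq0 := closedTriangle_mono hp hq
    rw [heq q hq0]
    have h1 : ∫ x in Ioo (q.1 - q.2) (q.1 + q.2), Ψ x ≤ ∫ x in Ioo (p.1 - p.2) (p.1 + p.2), Ψ x :=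
      setIntegral_mono_set (hΨ.mono_set hIoo)
        ((ae_restrict_iff' measurableSet_Ioo).2 (.of_forall fun x hx => hΨ0 x (hIoo hx)))
        (.of_forall (Ioo_subset_Ioo hq.2.2 hq.2.1))
    have h2 : ∫ x in backwardTriangle q, (F x - V x * w x) ≤
        ∫ x in backwardTriangle q, (max (F x) 0 + B * N * Real.exp (a * x.2)) := by
      refine setIntegral_mono_on (hint hFVw q hq0) (hint (hFp.add (hE.const_mul _)) q hq0)
        (measurableSet_backwardTriangle q) fun x hx => ?_
      have hx0 := closedTriangle_mono hq0 (backwardTriangle_subset_closedTriangle q hx)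
      have h3 : V x * -w x ≤ B * (N * Real.exp (a * x.2)) :=
        (mul_le_mul_of_nonneg_left ((le_max_left _ _).trans (hwN x hx0)) (hV0 x hx0)).trans
          (mul_le_mul_of_nonneg_right (hB x hx0) (by positivity))
      linarith [le_max_left (F x) 0]
    rw [integral_add (hint hFp q hq0) ((hint hE q hq0).const_mul _), integral_const_mul] at h2
    have h3 : ∫ x in backwardTriangle q, max (F x) 0 ≤ ∫ x in backwardTriangle p, max (F x) 0 :=
      setIntegral_mono_set (hint hFp p hp) (.of_forall fun x => le_max_right _ _)
        (.of_forall (backwardTriangle_mono hq))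
    have h4 := mul_le_mul_of_nonneg_left (hexp q hq0) (mul_nonneg hB0 hN0)
    linarith
  have hlower : ∫ x in backwardTriangle p, (max (F x) 0 - (C + B ^ 2 * (L / a)) * N *
      Real.exp (a * x.2) - P * V x) ≤ ∫ x in backwardTriangle p, (F x - V x * w x) := by
    refine setIntegral_mono_on (hint (by fun_prop) p hp) (hint hFVw p hp)
      (measurableSet_backwardTriangle p) fun x hx => ?_
    have hx' := backwardTriangle_subset_closedTriangle p hx
    have hx0 := closedTriangle_mono hp hx'
    have h1 : max (F x) 0 - C * N * Real.exp (a * x.2) ≤ F x := by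
      have h2 := mul_le_mul_of_nonneg_left (hwN x hx0) hC
      rcases le_total (F x) 0 with h3 | h3
      · rw [max_eq_right h3]
        linarith [hFw x hx0]
      · rw [max_eq_left h3]
        have : 0 ≤ C * N * Real.exp (a * x.2) := by positivity
        linarith
    have h2 := mul_le_mul_of_nonneg_left (hupper x hx') (hV0 x hx0)
    have h3 : V x * (B * N * (L / a) * Real.exp (a * x.2)) ≤
        B * (B * N * (L / a) * Real.exp (a * x.2)) :=
      mul_le_mul_of_nonneg_right (hB x hx0) (by positivity)
    nlinarith
  have hi1 : IntegrableOn (fun x : ℝ × ℝ => (C + B ^ 2 * (L / a)) * N * Real.exp (a * x.2))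
    (backwardTriangle p) := (hint hE p hp).const_mul _
  have hi2 : IntegrableOn (fun x : ℝ × ℝ => max (F x) 0 -
    (C + B ^ 2 * (L / a)) * N * Real.exp (a * x.2)) (backwardTriangle p) := (hint hFp p hp).sub hi1
  rw [integral_sub hi2 ((hint hV p hp).const_mul _),
    integral_sub (hint hFp p hp) hi1, integral_const_mul, integral_const_mul] at hlower
  have hD : (C + B ^ 2 * (L / a)) * (L / a) < 1 := by
    have h1 : L / a ≤ L := div_le_self hL0 ha1
    have h2 : (C + B ^ 2 * (L / a)) * (L / a) ≤ (C + B ^ 2 * L) * (L / a) := by gcongr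
    refine h2.trans_lt ?_
    rw [mul_div_assoc', div_lt_one ha0]
    linarith
  have hs := mul_le_mul_of_nonneg_left (hsmall p hp) hP0
  have he := mul_le_mul_of_nonneg_left (hexp p hp)
    (show 0 ≤ (C + B ^ 2 * (L / a)) * N by positivity)
  have hwp' := heq p hp
  have hfin : (C + B ^ 2 * (L / a)) * (L / a) * (N * Real.exp (a * p.2)) <
      1 * (N * Real.exp (a * p.2)) := mul_lt_mul_of_pos_right hD (by positivity)
  linarith

section

open Filter Topology Real

/-! ### Peak functions at the apex of a backward triangle -/

lemma contDiff_smoothTransition : ContDiff ℝ ∞ smoothTransition := smoothTransition.contDiff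

lemma continuous_deriv_smoothTransition : Continuous (deriv smoothTransition) :=
  contDiff_smoothTransition.continuous_deriv (by simp)

lemma hasDerivAt_smoothTransition (x : ℝ) :
    HasDerivAt smoothTransition (deriv smoothTransition x) x :=
  (contDiff_smoothTransition.differentiable (by simp) x).hasDerivAt

lemma deriv_smoothTransition_nonneg (x : ℝ) : 0 ≤ deriv smoothTransition x :=
  smoothTransition.monotone.deriv_nonneg

lemma deriv_smoothTransition_of_nonpos {x : ℝ} (hx : x ≤ 0) : deriv smoothTransition x = 0 := by
  refine IsLocalMin.deriv_eq_zero (Eventually.of_forall fun y => ?_)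
  rw [smoothTransition.zero_of_nonpos hx]
  exact smoothTransition.nonneg y

lemma deriv_smoothTransition_of_one_le {x : ℝ} (hx : 1 ≤ x) : deriv smoothTransition x = 0 := by
  refine IsLocalMax.deriv_eq_zero (Eventually.of_forall fun y => ?_)
  rw [smoothTransition.one_of_one_le hx]
  exact smoothTransition.le_one y

lemma integral_deriv_smoothTransition : ∫ x, deriv smoothTransition x = 1 := by
  have hc : HasCompactSupport (deriv smoothTransition) := by
    refine HasCompactSupport.intro (isCompact_Icc (a := (0 : ℝ)) (b := 1)) fun x hx => ?_
    rcases le_total x 0 with h | h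
    · exact deriv_smoothTransition_of_nonpos h
    · refine deriv_smoothTransition_of_one_le (le_of_not_gt fun h' => hx ⟨h, h'.le⟩)
  have h := integral_of_hasDerivAt_of_tendsto hasDerivAt_smoothTransition
    (continuous_deriv_smoothTransition.integrable_of_hasCompactSupport hc)
    (m := 0) (n := 1)
    (tendsto_const_nhds.congr' <| (eventually_le_atBot 0).mono fun x hx =>
      (smoothTransition.zero_of_nonpos hx).symm)
    (tendsto_const_nhds.congr' <| (eventually_ge_atTop 1).mono fun x hx =>
      (smoothTransition.one_of_one_le hx).symm)
  simpa using h

/-- The change to characteristic variables `(r, t) ↦ (r + t, r - t)` has Jacobian `2`. -/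
lemma integral_characteristic {f g : ℝ → ℝ} (hf : Continuous f) (hg : Continuous g) :
    ∫ q : ℝ × ℝ, f (q.1 + q.2) * g (q.1 - q.2) = 1 / 2 * ((∫ x, f x) * ∫ y, g y) := by
  set M : (ℝ × ℝ) →ₗ[ℝ] (ℝ × ℝ) :=
    Matrix.toLin (Module.Basis.finTwoProd ℝ) (Module.Basis.finTwoProd ℝ) !![1, 1; 1, -1] with hM
  have hMq : ∀ q : ℝ × ℝ, M q = (q.1 + q.2, q.1 - q.2) := fun q => by
    simp [hM, Matrix.toLin_finTwoProd_apply, sub_eq_add_neg]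
  have hdet : LinearMap.det M = -2 := by
    rw [hM, LinearMap.det_toLin]
    norm_num [Matrix.det_fin_two]
  have hmap := Measure.map_linearMap_addHaar_eq_smul_addHaar (volume : Measure (ℝ × ℝ))
    (f := M) (by rw [hdet]; norm_num)
  have hcont : Continuous M := M.continuous_of_finiteDimensional
  have h := integral_map (μ := (volume : Measure (ℝ × ℝ))) (φ := M)
    hcont.aemeasurable (f := fun z : ℝ × ℝ => f z.1 * g z.2)
    (by fun_prop : Continuous fun z : ℝ × ℝ => f z.1 * g z.2).aestronglyMeasurable
  simp only [hMq] at h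
  rw [← h, hmap, integral_smul_measure, hdet, Measure.volume_eq_prod, integral_prod_mul]
  norm_num [abs_of_neg]

/-- An approximate identity in characteristic variables, `N² σ(N (ξ₀ - r - t)) σ(N (r - t - ζ₀))`
with `σ` the derivative of the smooth step and `(ξ₀, ζ₀)` the characteristic coordinates of `p`.
Its mass is `1 / 2`, and for large `N` it lives in the backward triangle of `p`, near its apex. -/
noncomputable def peak (p : ℝ × ℝ) (N : ℝ) (q : ℝ × ℝ) : ℝ :=
  N * deriv smoothTransition (N * (p.1 + p.2 - (q.1 + q.2))) *
    (N * deriv smoothTransition (N * (q.1 - q.2 - (p.1 - p.2))))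

lemma continuous_peak (p : ℝ × ℝ) (N : ℝ) : Continuous (peak p N) := by
  have := continuous_deriv_smoothTransition
  unfold peak
  fun_prop

lemma peak_nonneg (p : ℝ × ℝ) {N : ℝ} (hN : 0 ≤ N) (q : ℝ × ℝ) : 0 ≤ peak p N q :=
  mul_nonneg (mul_nonneg hN (deriv_smoothTransition_nonneg _))
    (mul_nonneg hN (deriv_smoothTransition_nonneg _))

lemma peak_support {p q : ℝ × ℝ} {N : ℝ} (hN : 0 < N) (h : peak p N q ≠ 0) :
    (0 < p.1 + p.2 - (q.1 + q.2) ∧ p.1 + p.2 - (q.1 + q.2) < 1 / N) ∧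
      0 < q.1 - q.2 - (p.1 - p.2) ∧ q.1 - q.2 - (p.1 - p.2) < 1 / N := by
  have key : ∀ x : ℝ, N * deriv smoothTransition (N * x) ≠ 0 → 0 < x ∧ x < 1 / N := by
    intro x hx
    constructor <;> by_contra! hx' <;> refine hx (mul_eq_zero_of_right _ ?_)
    · exact deriv_smoothTransition_of_nonpos (mul_nonpos_of_nonneg_of_nonpos hN.le hx')
    · refine deriv_smoothTransition_of_one_le ?_
      rw [div_le_iff₀ hN] at hx'
      linarith
  exact ⟨key _ (left_ne_zero_of_mul h), key _ (right_ne_zero_of_mul h)⟩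

lemma integral_peak (p : ℝ × ℝ) {N : ℝ} (hN : 0 < N) : ∫ q, peak p N q = 1 / 2 := by
  have hc := continuous_deriv_smoothTransition
  have h := integral_characteristic
    (f := fun x => N * deriv smoothTransition (N * (p.1 + p.2 - x)))
    (g := fun y => N * deriv smoothTransition (N * (y - (p.1 - p.2)))) (by fun_prop) (by fun_prop)
  have h1 : ∫ x, N * deriv smoothTransition (N * x) = 1 := by
    rw [integral_const_mul, Measure.integral_comp_mul_left (fun x => deriv smoothTransition x),
      integral_deriv_smoothTransition, abs_of_pos (by positivity)]
    simp [hN.ne']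
  rw [integral_sub_left_eq_self (fun x => N * deriv smoothTransition (N * x)),
    integral_sub_right_eq_self (fun x => N * deriv smoothTransition (N * x)), h1] at h
  simpa [peak] using h

lemma tendsto_integral_peak {p : ℝ × ℝ} (hp : 0 < p.2) {v : ℝ × ℝ → ℝ}
    (hv : ContinuousOn v (closedTriangle p)) :
    Tendsto (fun N : ℕ => ∫ q in backwardTriangle p, peak p N q * v q) atTop (𝓝 (v p / 2)) := by
  have hpK : p ∈ closedTriangle p := ⟨hp.le, le_rfl, le_rfl⟩
  have hlarge : ∀ δ : ℝ, 0 < δ → ∀ᶠ N : ℕ in atTop, 0 < (N : ℝ) ∧ 1 / (N : ℝ) < δ := by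
    intro δ hδ
    filter_upwards [tendsto_natCast_atTop_atTop.eventually_gt_atTop (1 / δ)] with N hN
    have : 0 < (N : ℝ) := lt_trans (by positivity) hN
    exact ⟨this, by rwa [one_div_lt this hδ]⟩
  have h := tendsto_setIntegral_peak_smul_of_integrableOn_of_tendsto (μ := volume) (x₀ := p)
    (a := v p) (φ := fun (N : ℕ) q => 2 * peak p N q) (l := atTop)
    (measurableSet_backwardTriangle p)
    (measurableSet_backwardTriangle p) subset_rfl self_mem_nhdsWithin
    ((measure_mono (backwardTriangle_subset_closedTriangle p)).trans_lt
      (isCompact_closedTriangle p).measure_lt_top).ne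
    (.of_forall fun N q _ => mul_nonneg zero_le_two (peak_nonneg p N.cast_nonneg q)) ?_ ?_
    (.of_forall fun N => ((continuous_peak p N).const_mul _).aestronglyMeasurable)
    (integrableOn_backwardTriangle hv)
    ((hv p hpK).mono (backwardTriangle_subset_closedTriangle p))
  · have h2 := h.div_const 2
    refine h2.congr fun N => ?_
    rw [← integral_div]
    refine integral_congr_ae (.of_forall fun q => ?_)
    simp only [smul_eq_mul]
    ring
  · intro u hu hpu
    obtain ⟨δ, hδ, hball⟩ := Metric.isOpen_iff.1 hu p hpu
    refine Metric.tendstoUniformlyOn_iff.2 fun ε hε => ?_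
    filter_upwards [hlarge δ hδ] with N hN q hq
    have h0 : peak p N q = 0 := by
      by_contra hne
      obtain ⟨⟨h1, h2⟩, h3, h4⟩ := peak_support hN.1 hne
      refine hq.2 (hball ?_)
      rw [Metric.mem_ball, Prod.dist_eq, max_lt_iff, Real.dist_eq, Real.dist_eq, abs_lt, abs_lt]
      refine ⟨⟨?_, ?_⟩, ?_, ?_⟩ <;> linarith [hN.2]
    simpa [h0] using hε
  · refine tendsto_const_nhds.congr' ?_
    filter_upwards [hlarge p.2 hp] with N hN
    rw [setIntegral_eq_integral_of_forall_compl_eq_zero, integral_const_mul, integral_peak p hN.1]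
    · norm_num
    · intro q hq
      by_contra hne
      obtain ⟨⟨h1, h2⟩, h3, h4⟩ := peak_support hN.1 (right_ne_zero_of_mul hne)
      exact hq ⟨by linarith [hN.2], by linarith, by linarith⟩

/-! ### D'Alembert's formula for weak solutions -/

/-- With `k = (n - 1) / 2`, conjugation by `r ^ k` turns the radial d'Alembertian into
`∂_t² - ∂_r² + k (k - 1) / r²`, and `∂_t² - ∂_r²` is `-4 ∂_ξ ∂_ζ` in `ξ = r + t`, `ζ = r - t`. -/
lemma radialBox_of_eventuallyEq {n : ℕ} {k : ℝ} (hk : k = ((n : ℝ) - 1) / 2) {A B : ℝ → ℝ}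
    (hA : ContDiff ℝ ∞ A) (hB : ContDiff ℝ ∞ B) {φ : ℝ × ℝ → ℝ} {q : ℝ × ℝ} (hq : 0 < q.1)
    (h : φ =ᶠ[𝓝 q] fun x => x.1 ^ (-k) * (A (x.1 + x.2) * B (x.1 - x.2))) :
    radialBox n φ q = q.1 ^ (-k) * (-4 * (deriv A (q.1 + q.2) * deriv B (q.1 - q.2)) +
      k * (k - 1) / q.1 ^ 2 * (A (q.1 + q.2) * B (q.1 - q.2))) := by
  obtain ⟨r, t⟩ := q
  simp only at hq h ⊢
  have hA1 : ∀ x, HasDerivAt A (deriv A x) x := fun x =>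
    (hA.differentiable (by simp) x).hasDerivAt
  have hB1 : ∀ x, HasDerivAt B (deriv B x) x := fun x =>
    (hB.differentiable (by simp) x).hasDerivAt
  have hA2 : ∀ x, HasDerivAt (deriv A) (deriv (deriv A) x) x := fun x =>
    ((hA.iterate_deriv 1).differentiable (by simp) x).hasDerivAt
  have hB2 : ∀ x, HasDerivAt (deriv B) (deriv (deriv B) x) x := fun x =>
    ((hB.iterate_deriv 1).differentiable (by simp) x).hasDerivAt
  have hr : (fun y => φ (y, t)) =ᶠ[𝓝 r] fun y => y ^ (-k) * (A (y + t) * B (y - t)) :=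
    h.comp_tendsto (Continuous.tendsto (by fun_prop : Continuous fun y : ℝ => (y, t)) r)
  have ht : (fun s => φ (r, s)) =ᶠ[𝓝 t] fun s => r ^ (-k) * (A (r + s) * B (r - s)) :=
    h.comp_tendsto (Continuous.tendsto (by fun_prop : Continuous fun s : ℝ => (r, s)) t)
  have hpow : ∀ a y : ℝ, 0 < y → HasDerivAt (fun y : ℝ => y ^ a) (a * y ^ (a - 1)) y :=
    fun a y hy => Real.hasDerivAt_rpow_const (Or.inl hy.ne')
  have hAp : ∀ y s, HasDerivAt (fun y => A (y + s)) (deriv A (y + s)) y := fun y s => by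
    simpa using (hA1 (y + s)).comp_add_const y s
  have hBp : ∀ y s, HasDerivAt (fun y => B (y - s)) (deriv B (y - s)) y := fun y s => by
    simpa using (hB1 (y - s)).comp_sub_const y s
  have hAp2 : ∀ y s, HasDerivAt (fun y => deriv A (y + s)) (deriv (deriv A) (y + s)) y :=
    fun y s => by simpa using (hA2 (y + s)).comp_add_const y s
  have hBp2 : ∀ y s, HasDerivAt (fun y => deriv B (y - s)) (deriv (deriv B) (y - s)) y :=
    fun y s => by simpa using (hB2 (y - s)).comp_sub_const y s
  have hAt : ∀ y s, HasDerivAt (fun s => A (y + s)) (deriv A (y + s)) s := fun y s => by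
    simpa using (hA1 (y + s)).comp_const_add y s
  have hBt : ∀ y s, HasDerivAt (fun s => B (y - s)) (-deriv B (y - s)) s := fun y s => by
    simpa using (hB1 (y - s)).comp_const_sub y s
  have hAt2 : ∀ y s, HasDerivAt (fun s => deriv A (y + s)) (deriv (deriv A) (y + s)) s :=
    fun y s => by simpa using (hA2 (y + s)).comp_const_add y s
  have hBt2 : ∀ y s, HasDerivAt (fun s => deriv B (y - s)) (-deriv (deriv B) (y - s)) s :=
    fun y s => by simpa using (hB2 (y - s)).comp_const_sub y s
  have ht1 : deriv (fun s => r ^ (-k) * (A (r + s) * B (r - s))) = fun s =>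
      r ^ (-k) * (deriv A (r + s) * B (r - s) + A (r + s) * -deriv B (r - s)) :=
    funext fun s => (((hAt r s).mul (hBt r s)).const_mul _).deriv
  have ht2 : iteratedDeriv 2 (fun s => φ (r, s)) t =
      r ^ (-k) * (deriv (deriv A) (r + t) * B (r - t) + deriv A (r + t) * -deriv B (r - t) +
        (deriv A (r + t) * -deriv B (r - t) + A (r + t) * -(-deriv (deriv B) (r - t)))) := by
    rw [ht.iteratedDeriv_eq 2, iteratedDeriv_succ, iteratedDeriv_one, ht1]
    exact ((((hAt2 r t).mul (hBt r t)).add ((hAt r t).mul (hBt2 r t).neg)).const_mul _).deriv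
  have hr1' : ∀ y, 0 < y → HasDerivAt (fun y => y ^ (-k) * (A (y + t) * B (y - t)))
      (-k * y ^ (-k - 1) * (A (y + t) * B (y - t)) +
        y ^ (-k) * (deriv A (y + t) * B (y - t) + A (y + t) * deriv B (y - t))) y :=
    fun y hy => (hpow (-k) y hy).mul ((hAp y t).mul (hBp y t))
  have hr1 := (hr.deriv_eq).trans (hr1' r hq).deriv
  have hr2 : iteratedDeriv 2 (fun y => φ (y, t)) r =
      -k * ((-k - 1) * r ^ (-k - 1 - 1)) * (A (r + t) * B (r - t)) +
        -k * r ^ (-k - 1) * (deriv A (r + t) * B (r - t) + A (r + t) * deriv B (r - t)) +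
      (-k * r ^ (-k - 1) * (deriv A (r + t) * B (r - t) + A (r + t) * deriv B (r - t)) +
        r ^ (-k) * (deriv (deriv A) (r + t) * B (r - t) + deriv A (r + t) * deriv B (r - t) +
          (deriv A (r + t) * deriv B (r - t) + A (r + t) * deriv (deriv B) (r - t)))) := by
    rw [hr.iteratedDeriv_eq 2, iteratedDeriv_succ, iteratedDeriv_one]
    have hev : deriv (fun y => y ^ (-k) * (A (y + t) * B (y - t))) =ᶠ[𝓝 r] fun y =>
        -k * y ^ (-k - 1) * (A (y + t) * B (y - t)) +
        y ^ (-k) * (deriv A (y + t) * B (y - t) + A (y + t) * deriv B (y - t)) :=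
      (lt_mem_nhds hq).mono fun y hy => (hr1' y hy).deriv
    rw [hev.deriv_eq]
    exact ((((hpow (-k - 1) r hq).const_mul (-k)).mul ((hAp r t).mul (hBp r t))).add
      ((hpow (-k) r hq).mul (((hAp2 r t).mul (hBp r t)).add ((hAp r t).mul (hBp2 r t))))).deriv
  have hn : (n : ℝ) - 1 = 2 * k := by rw [hk]; ring
  unfold radialBox
  simp only at *
  rw [ht2, hr2, hr1, hn, Real.rpow_sub_one hq.ne', Real.rpow_sub_one hq.ne']
  field_simp
  ring

/-- `s (N (ξ₀ - ξ))`, a smooth approximation of the indicator function of `ξ < ξ₀`. -/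
noncomputable def stepLeft (N ξ₀ ξ : ℝ) : ℝ := smoothTransition (N * (ξ₀ - ξ))

/-- `s (N (ζ - ζ₀))`, a smooth approximation of the indicator function of `ζ > ζ₀`. -/
noncomputable def stepRight (N ζ₀ ζ : ℝ) : ℝ := smoothTransition (N * (ζ - ζ₀))

/-- A smooth approximation of the indicator function of the backward cone of `p`. It is supported
in this cone, and `-4 ∂_ξ ∂_ζ` maps it to `4 * peak p N`. -/
noncomputable def coneCutoff (p : ℝ × ℝ) (N : ℝ) (q : ℝ × ℝ) : ℝ :=
  stepLeft N (p.1 + p.2) (q.1 + q.2) * stepRight N (p.1 - p.2) (q.1 - q.2)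

lemma contDiff_stepLeft (N ξ₀ : ℝ) : ContDiff ℝ ∞ (stepLeft N ξ₀) :=
  contDiff_smoothTransition.comp (by fun_prop)

lemma contDiff_stepRight (N ζ₀ : ℝ) : ContDiff ℝ ∞ (stepRight N ζ₀) :=
  contDiff_smoothTransition.comp (by fun_prop)

lemma deriv_stepLeft (N ξ₀ ξ : ℝ) :
    deriv (stepLeft N ξ₀) ξ = -(N * deriv smoothTransition (N * (ξ₀ - ξ))) := by
  have h : HasDerivAt (fun ξ => N * (ξ₀ - ξ)) (-N) ξ := by
    simpa using ((hasDerivAt_id ξ).const_sub ξ₀).const_mul N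
  refine ((hasDerivAt_smoothTransition _).comp ξ h).deriv.trans ?_
  ring

lemma deriv_stepRight (N ζ₀ ζ : ℝ) :
    deriv (stepRight N ζ₀) ζ = N * deriv smoothTransition (N * (ζ - ζ₀)) := by
  have h : HasDerivAt (fun ζ => N * (ζ - ζ₀)) N ζ := by
    simpa using ((hasDerivAt_id ζ).sub_const ζ₀).const_mul N
  refine ((hasDerivAt_smoothTransition _).comp ζ h).deriv.trans ?_
  ring

lemma contDiff_coneCutoff (p : ℝ × ℝ) (N : ℝ) : ContDiff ℝ ∞ (coneCutoff p N) :=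
  ((contDiff_stepLeft _ _).comp (by fun_prop)).mul ((contDiff_stepRight _ _).comp (by fun_prop))

lemma coneCutoff_nonneg (p : ℝ × ℝ) (N : ℝ) (q : ℝ × ℝ) : 0 ≤ coneCutoff p N q :=
  mul_nonneg (smoothTransition.nonneg _) (smoothTransition.nonneg _)

lemma coneCutoff_le_one (p : ℝ × ℝ) (N : ℝ) (q : ℝ × ℝ) : coneCutoff p N q ≤ 1 :=
  mul_le_one₀ (smoothTransition.le_one _) (smoothTransition.nonneg _) (smoothTransition.le_one _)

lemma coneCutoff_support {p q : ℝ × ℝ} {N : ℝ} (hN : 0 ≤ N) (h : coneCutoff p N q ≠ 0) :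
    q.1 + q.2 < p.1 + p.2 ∧ p.1 - p.2 < q.1 - q.2 := by
  constructor <;> by_contra! hx
  · refine h (mul_eq_zero_of_left (smoothTransition.zero_of_nonpos ?_) _)
    exact mul_nonpos_of_nonneg_of_nonpos hN (by linarith)
  · refine h (mul_eq_zero_of_right _ (smoothTransition.zero_of_nonpos ?_))
    exact mul_nonpos_of_nonneg_of_nonpos hN (by linarith)

lemma tendsto_coneCutoff {p q : ℝ × ℝ} (h1 : q.1 + q.2 < p.1 + p.2) (h2 : p.1 - p.2 < q.1 - q.2) :
    Tendsto (fun N : ℕ => coneCutoff p N q) atTop (𝓝 1) := by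
  have key : ∀ x : ℝ, 0 < x → ∀ᶠ N : ℕ in atTop, smoothTransition (N * x) = 1 := by
    intro x hx
    filter_upwards [tendsto_natCast_atTop_atTop.eventually_ge_atTop (1 / x)] with N hN
    rw [div_le_iff₀ hx] at hN
    exact smoothTransition.one_of_one_le hN
  refine tendsto_const_nhds.congr' ?_
  filter_upwards [key _ (sub_pos.2 h1), key _ (sub_pos.2 h2)] with N hN1 hN2
  simp [coneCutoff, stepLeft, stepRight, hN1, hN2]

lemma tendsto_integral_mul_coneCutoff {p : ℝ × ℝ} {f : ℝ × ℝ → ℝ}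
    (hf : IntegrableOn f (backwardTriangle p)) :
    Tendsto (fun N : ℕ => ∫ q in backwardTriangle p, f q * coneCutoff p N q) atTop
      (𝓝 (∫ q in backwardTriangle p, f q)) := by
  refine tendsto_integral_of_dominated_convergence (fun q => ‖f q‖) (fun N => ?_) hf.norm
    (fun N => .of_forall fun q => ?_) ?_
  · exact hf.aestronglyMeasurable.mul (contDiff_coneCutoff p N).continuous.aestronglyMeasurable
  · rw [norm_mul, Real.norm_of_nonneg (coneCutoff_nonneg p N q)]
    exact mul_le_of_le_one_right (norm_nonneg _) (coneCutoff_le_one p N q)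
  · refine (ae_restrict_iff' (measurableSet_backwardTriangle p)).2 (.of_forall fun q hq => ?_)
    simpa using (tendsto_coneCutoff hq.2.1 hq.2.2).const_mul (f q)

lemma tendsto_integral_mul_coneCutoff_initial {p : ℝ × ℝ} {f : ℝ → ℝ}
    (hf : IntegrableOn f (Ioo (p.1 - p.2) (p.1 + p.2))) :
    Tendsto (fun N : ℕ => ∫ r in Ioo (p.1 - p.2) (p.1 + p.2), f r * coneCutoff p N (r, 0)) atTop
      (𝓝 (∫ r in Ioo (p.1 - p.2) (p.1 + p.2), f r)) := by
  refine tendsto_integral_of_dominated_convergence (fun r => ‖f r‖) (fun N => ?_) hf.norm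
    (fun N => .of_forall fun r => ?_) ?_
  · exact hf.aestronglyMeasurable.mul
      ((contDiff_coneCutoff p N).continuous.comp
        (by fun_prop : Continuous fun r : ℝ => (r, (0 : ℝ)))).aestronglyMeasurable
  · rw [norm_mul, Real.norm_of_nonneg (coneCutoff_nonneg p N _)]
    exact mul_le_of_le_one_right (norm_nonneg _) (coneCutoff_le_one p N _)
  · refine (ae_restrict_iff' measurableSet_Ioo).2 (.of_forall fun r hr => ?_)
    simpa using (tendsto_coneCutoff (p := p) (q := (r, 0)) (by simpa using hr.2)
      (by simpa using hr.1)).const_mul (f r)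

/-- The test function `r ^ (-k) * coneCutoff p N`, cut off in `t < 0`, where it does not matter,
so that its support is compact and stays away from `r = 0`. -/
noncomputable def coneTest (k : ℝ) (p : ℝ × ℝ) (N : ℝ) (q : ℝ × ℝ) : ℝ :=
  smoothTransition (2 + 4 / (p.1 - p.2) * q.2) * (q.1 ^ (-k) * coneCutoff p N q)

lemma coneTest_support {k : ℝ} {p q : ℝ × ℝ} {N : ℝ} (hp : 0 < p.1 - p.2) (hN : 0 ≤ N)
    (h : coneTest k p N q ≠ 0) :
    q.1 + q.2 < p.1 + p.2 ∧ p.1 - p.2 < q.1 - q.2 ∧ -(p.1 - p.2) / 2 < q.2 := by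
  obtain ⟨h1, h2⟩ := coneCutoff_support hN (right_ne_zero_of_mul (right_ne_zero_of_mul h))
  refine ⟨h1, h2, ?_⟩
  by_contra! hx
  refine h (mul_eq_zero_of_left (smoothTransition.zero_of_nonpos ?_) _)
  have h3 := mul_le_mul_of_nonneg_left hx (show 0 ≤ 4 / (p.1 - p.2) by positivity)
  have h4 : 4 / (p.1 - p.2) * (-(p.1 - p.2) / 2) = -2 := by field_simp; norm_num
  linarith

lemma coneTest_eventuallyEq {k : ℝ} {p q : ℝ × ℝ} {N : ℝ} (hp : 0 < p.1 - p.2) (hq : 0 ≤ q.2) :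
    coneTest k p N =ᶠ[𝓝 q] fun x => x.1 ^ (-k) * coneCutoff p N x := by
  have h : ∀ᶠ x : ℝ × ℝ in 𝓝 q, 1 < 2 + 4 / (p.1 - p.2) * x.2 := by
    refine (by fun_prop : ContinuousAt (fun x : ℝ × ℝ => 2 + 4 / (p.1 - p.2) * x.2)
      q).eventually_const_lt ?_
    have : 0 ≤ 4 / (p.1 - p.2) * q.2 := by positivity
    linarith
  filter_upwards [h] with x hx
  rw [coneTest, smoothTransition.one_of_one_le hx.le, one_mul]

lemma contDiff_coneTest {k : ℝ} {p : ℝ × ℝ} {N : ℝ} (hp : 0 < p.1 - p.2) (hN : 0 ≤ N) :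
    ContDiff ℝ ∞ (coneTest k p N) := by
  refine contDiff_iff_contDiffAt.2 fun q => ?_
  rcases lt_or_ge 0 q.1 with hq | hq
  · refine ContDiffAt.mul ?_ (ContDiffAt.mul ?_ (contDiff_coneCutoff p N).contDiffAt)
    · exact (contDiff_smoothTransition.comp (by fun_prop :
        ContDiff ℝ ∞ fun q : ℝ × ℝ => 2 + 4 / (p.1 - p.2) * q.2)).contDiffAt
    · exact contDiffAt_fst.rpow_const_of_ne hq.ne'
  · refine contDiffAt_const (c := (0 : ℝ)) |>.congr_of_eventuallyEq ?_
    have h : ∀ᶠ x : ℝ × ℝ in 𝓝 q, x.1 < (p.1 - p.2) / 2 :=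
      continuous_fst.continuousAt.eventually_lt_const (by linarith)
    filter_upwards [h] with x hx
    by_contra hne
    obtain ⟨-, h2, h3⟩ := coneTest_support hp hN hne
    linarith

lemma tsupport_coneTest {k : ℝ} {p : ℝ × ℝ} {N : ℝ} (hp : 0 < p.1 - p.2) (hN : 0 ≤ N) :
    tsupport (coneTest k p N) ⊆
      {q | q.1 + q.2 ≤ p.1 + p.2 ∧ p.1 - p.2 ≤ q.1 - q.2 ∧ -(p.1 - p.2) / 2 ≤ q.2} := by
  refine closure_minimal (fun q hq => ?_) ?_
  · obtain ⟨h1, h2, h3⟩ := coneTest_support hp hN hq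
    exact ⟨h1.le, h2.le, h3.le⟩
  · exact (isClosed_le (continuous_fst.add continuous_snd) continuous_const).inter
      ((isClosed_le continuous_const (continuous_fst.sub continuous_snd)).inter
        (isClosed_le continuous_const continuous_snd))

lemma hasCompactSupport_coneTest {k : ℝ} {p : ℝ × ℝ} {N : ℝ} (hp : 0 < p.1 - p.2) (hN : 0 ≤ N) :
    HasCompactSupport (coneTest k p N) := by
  refine (isCompact_Icc (a := (0, -(p.1 - p.2) / 2)) (b := (2 * p.1, p.2))).of_isClosed_subset
    (isClosed_tsupport _) ((tsupport_coneTest hp hN).trans ?_)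
  rintro ⟨x, s⟩ ⟨h1, h2, h3⟩
  simp only at h1 h2 h3
  refine ⟨⟨?_, ?_⟩, ⟨?_, ?_⟩⟩ <;> simp only <;> linarith

lemma radialBox_coneTest {n : ℕ} {k : ℝ} (hk : k = ((n : ℝ) - 1) / 2) {p q : ℝ × ℝ} {N : ℝ}
    (hp : 0 < p.1 - p.2) (hq : 0 < q.1) (hq' : 0 ≤ q.2) :
    radialBox n (coneTest k p N) q =
      q.1 ^ (-k) * (4 * peak p N q + k * (k - 1) / q.1 ^ 2 * coneCutoff p N q) := by
  rw [radialBox_of_eventuallyEq hk (contDiff_stepLeft N (p.1 + p.2))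
    (contDiff_stepRight N (p.1 - p.2)) hq (coneTest_eventuallyEq hp hq'),
    deriv_stepLeft, deriv_stepRight, peak, coneCutoff]
  ring

lemma closedTriangle_subset_Theta {R : ℝ} {T : EReal} {p : ℝ × ℝ} (hR : p.2 + R < p.1)
    (hT : (p.2 : EReal) < T) : closedTriangle p ⊆ Theta R T := fun q hq =>
  ⟨by linarith [hq.2.2], hq.1, lt_of_le_of_lt
    (EReal.coe_le_coe_iff.2 (snd_le_of_mem_closedTriangle hq)) hT⟩

lemma rpow_neg_mul_pow {n : ℕ} (hn : 1 ≤ n) {k : ℝ} (hk : k = ((n : ℝ) - 1) / 2) {r : ℝ}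
    (hr : 0 < r) : r ^ (-k) * r ^ (n - 1) = r ^ k := by
  rw [← Real.rpow_natCast, ← Real.rpow_add hr]
  congr 1
  push_cast [hn]
  rw [hk]
  ring

lemma measurableSet_Theta (R : ℝ) (T : EReal) : MeasurableSet (Theta R T) :=
  (measurableSet_lt (measurable_snd.add_const R) measurable_fst).inter
    ((measurableSet_le measurable_const measurable_snd).inter
      (measurableSet_lt (measurable_coe_real_ereal.comp measurable_snd) measurable_const))

/-- D'Alembert's formula at `p` for `v = r ^ k * u`, which solves
`v_tt - v_rr + k (k - 1) / r² v = r ^ k * g(r, u)` if `u` solves the radial wave equation in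
dimension `2 k + 1`; here `u = 0` and `u_t = ψ` at `t = 0`. The potential is treated as a part of
the source. -/
def DAlembertFormula (k : ℝ) (g : ℝ → ℝ → ℝ) (ψ : ℝ → ℝ) (u : ℝ × ℝ → ℝ) (p : ℝ × ℝ) : Prop :=
  p.1 ^ k * u p = 1 / 2 * (∫ r in Ioo (p.1 - p.2) (p.1 + p.2), r ^ k * ψ r) +
    1 / 2 * ∫ q in backwardTriangle p,
      (q.1 ^ k * g q.1 (u q) - k * (k - 1) / q.1 ^ 2 * (q.1 ^ k * u q))

/-- Testing the equation with `r ^ (-k) * coneCutoff p N` and letting `N → ∞` yields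
d'Alembert's formula at `p`. -/
theorem IsSolution.dAlembert {n : ℕ} (hn : 1 ≤ n) {R : ℝ} (hR : 0 < R) {T : EReal}
    {g : ℝ → ℝ → ℝ} {ψ : ℝ → ℝ} {u : ℝ × ℝ → ℝ} (hu : IsSolution n R T g ψ u)
    (hg : ContinuousOn (fun q : ℝ × ℝ => g q.1 q.2) (Ioi R ×ˢ univ))
    (hψ : ContinuousOn ψ (Ioi R)) {k : ℝ} (hk : k = ((n : ℝ) - 1) / 2)
    {p : ℝ × ℝ} (hp0 : 0 ≤ p.2) (hpR : p.2 + R < p.1) (hpT : (p.2 : EReal) < T) :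
    DAlembertFormula k g ψ u p := by
  unfold DAlembertFormula
  have hζ : 0 < p.1 - p.2 := by linarith
  have hK := closedTriangle_subset_Theta hpR hpT
  have hK' := (backwardTriangle_subset_closedTriangle p).trans hK
  have hpos : ∀ q ∈ Theta R T, 0 < q.1 := fun q hq => by linarith [hq.1, hq.2.1]
  have hΘR : ∀ q ∈ Theta R T, R < q.1 := fun q hq => by linarith [hq.1, hq.2.1]
  rcases hp0.eq_or_lt with hp0' | hp0'
  · -- on the initial line the triangle is degenerate
    have h1 : u p = 0 := by
      have := hu.initial p.1 (by rw [hp0']; exact ⟨hpR, hp0, hpT⟩)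
      rwa [show (p.1, (0 : ℝ)) = p from Prod.ext rfl hp0'] at this
    have h2 : backwardTriangle p = ∅ := by
      refine eq_empty_of_forall_notMem fun q hq => ?_
      linarith [hq.1, hq.2.1, hq.2.2]
    simp [h1, h2, ← hp0']
  have hcu : ContinuousOn u (closedTriangle p) := hu.continuousOn.mono hK
  have hcpow : ContinuousOn (fun q : ℝ × ℝ => q.1 ^ k) (closedTriangle p) :=
    continuousOn_fst.rpow_const fun q hq => Or.inl (hpos q (hK hq)).ne'
  have hcv : ContinuousOn (fun q => q.1 ^ k * u q) (closedTriangle p) := hcpow.mul hcu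
  have hcg : ContinuousOn (fun q => q.1 ^ k * g q.1 (u q)) (closedTriangle p) :=
    hcpow.mul (hg.comp (continuousOn_fst.prodMk hcu) fun q hq => ⟨hΘR q (hK hq), mem_univ _⟩)
  have hcV : ContinuousOn (fun q => k * (k - 1) / q.1 ^ 2 * (q.1 ^ k * u q)) (closedTriangle p) :=
    (continuousOn_const.div (continuousOn_fst.pow 2)
      fun q hq => (pow_pos (hpos q (hK hq)) 2).ne').mul hcv
  have hIcc : Icc (p.1 - p.2) (p.1 + p.2) ⊆ Ioi R := fun x hx => by
    have := hx.1
    simp only [mem_Ioi]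
    linarith
  have hcψ : ContinuousOn (fun r => r ^ k * ψ r) (Icc (p.1 - p.2) (p.1 + p.2)) :=
    (continuousOn_id.rpow_const fun x hx => Or.inl (hR.trans (hIcc hx)).ne').mul (hψ.mono hIcc)
  have hiψ : IntegrableOn (fun r => r ^ k * ψ r) (Ioo (p.1 - p.2) (p.1 + p.2)) :=
    (hcψ.integrableOn_compact isCompact_Icc).mono_set Ioo_subset_Icc_self
  have hiv : ∀ N : ℕ, IntegrableOn (fun q => 4 * (peak p N q * (q.1 ^ k * u q)))
      (backwardTriangle p) := fun N => integrableOn_backwardTriangle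
    (((continuous_peak p N).continuousOn.mul hcv).const_mul 4)
  have hiV : ∀ N : ℕ, IntegrableOn
      (fun q => k * (k - 1) / q.1 ^ 2 * (q.1 ^ k * u q) * coneCutoff p N q)
      (backwardTriangle p) := fun N => integrableOn_backwardTriangle
    (hcV.mul (contDiff_coneCutoff p N).continuous.continuousOn)
  have hcut : ∀ N : ℕ, ∀ q ∈ Theta R T \ backwardTriangle p, coneCutoff p N q = 0 := by
    intro N q hq
    by_contra hne
    exact hq.2 ⟨hq.1.2.1, coneCutoff_support N.cast_nonneg hne⟩
  have hpk : ∀ N : ℕ, ∀ q ∈ Theta R T \ backwardTriangle p, peak p N q = 0 := by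
    intro N q hq
    by_contra hne
    have hN : (0 : ℝ) < N := by
      rcases (Nat.cast_nonneg (α := ℝ) N).eq_or_lt with h | h
      · exact absurd (by rw [peak, ← h, zero_mul, zero_mul]) hne
      · exact h
    obtain ⟨⟨h1, -⟩, h2, -⟩ := peak_support hN hne
    exact hq.2 ⟨hq.1.2.1, by linarith, by linarith⟩
  have hident : ∀ N : ℕ,
      4 * (∫ q in backwardTriangle p, peak p N q * (q.1 ^ k * u q)) +
        ∫ q in backwardTriangle p, k * (k - 1) / q.1 ^ 2 * (q.1 ^ k * u q) * coneCutoff p N q =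
      (∫ q in backwardTriangle p, q.1 ^ k * g q.1 (u q) * coneCutoff p N q) +
        ∫ r in Ioo (p.1 - p.2) (p.1 + p.2), r ^ k * ψ r * coneCutoff p N (r, 0) := by
    intro N
    have hN : (0 : ℝ) ≤ N := N.cast_nonneg
    have htest : ∀ q : ℝ × ℝ, 0 ≤ q.2 → coneTest k p N q = q.1 ^ (-k) * coneCutoff p N q :=
      fun q hq => (coneTest_eventuallyEq hζ hq).eq_of_nhds
    have h := hu.equation (coneTest k p N) (contDiff_coneTest hζ hN)
      (hasCompactSupport_coneTest hζ hN) fun q hq =>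
        hK ⟨hq.2, (tsupport_coneTest hζ hN hq.1).1, (tsupport_coneTest hζ hN hq.1).2.1⟩
    have e1 : ∫ q in Theta R T, u q * radialBox n (coneTest k p N) q * q.1 ^ (n - 1) =
        ∫ q in backwardTriangle p, (4 * (peak p N q * (q.1 ^ k * u q)) +
          k * (k - 1) / q.1 ^ 2 * (q.1 ^ k * u q) * coneCutoff p N q) := by
      rw [← setIntegral_eq_of_subset_of_forall_sdiff_eq_zero (measurableSet_Theta R T) hK'
        fun q hq => by rw [hcut N q hq, hpk N q hq]; ring]
      refine setIntegral_congr_fun (measurableSet_Theta R T) fun q hq => ?_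
      rw [radialBox_coneTest hk hζ (hpos q hq) hq.2.1, ← rpow_neg_mul_pow hn hk (hpos q hq)]
      ring
    have e2 : ∫ q in Theta R T, g q.1 (u q) * coneTest k p N q * q.1 ^ (n - 1) =
        ∫ q in backwardTriangle p, q.1 ^ k * g q.1 (u q) * coneCutoff p N q := by
      rw [← setIntegral_eq_of_subset_of_forall_sdiff_eq_zero (measurableSet_Theta R T) hK'
        fun q hq => by rw [hcut N q hq]; ring]
      refine setIntegral_congr_fun (measurableSet_Theta R T) fun q hq => ?_
      rw [htest q hq.2.1, ← rpow_neg_mul_pow hn hk (hpos q hq)]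
      ring
    have e3 : ∫ r in Ioi R, ψ r * coneTest k p N (r, 0) * r ^ (n - 1) =
        ∫ r in Ioo (p.1 - p.2) (p.1 + p.2), r ^ k * ψ r * coneCutoff p N (r, 0) := by
      rw [← setIntegral_eq_of_subset_of_forall_sdiff_eq_zero measurableSet_Ioi
        (Ioo_subset_Icc_self.trans hIcc) fun r hr => ?_]
      · refine setIntegral_congr_fun measurableSet_Ioi fun r hr => ?_
        rw [htest (r, 0) le_rfl, ← rpow_neg_mul_pow hn hk (hR.trans hr)]
        ring
      · have : coneCutoff p N (r, 0) = 0 := by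
          by_contra hne
          obtain ⟨h1, h2⟩ := coneCutoff_support hN hne
          simp only [add_zero, sub_zero] at h1 h2
          exact hr.2 ⟨h2, h1⟩
        rw [this, mul_zero]
    rw [e1, e2, e3, integral_add (hiv N) (hiV N), integral_const_mul] at h
    exact h
  have hiG := integrableOn_backwardTriangle hcg
  have hiU := integrableOn_backwardTriangle hcV
  have hlim := tendsto_nhds_unique
    (((tendsto_integral_peak hp0' hcv).const_mul 4).add (tendsto_integral_mul_coneCutoff hiU))
    (((tendsto_integral_mul_coneCutoff hiG).add
      (tendsto_integral_mul_coneCutoff_initial hiψ)).congr fun N => (hident N).symm)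
  rw [integral_sub hiG hiU]
  linarith

end

/-! ### Comparison of solutions -/

lemma exists_lipschitz_bound {R : ℝ} {g : ℝ → ℝ → ℝ}
    (hg : ContDiffOn ℝ 1 (fun q : ℝ × ℝ => g q.1 q.2) (Ioi R ×ˢ univ)) {a b : ℝ} (ha : R < a)
    (M : ℝ) : ∃ D, 0 ≤ D ∧ ∀ r ∈ Icc a b, ∀ v ∈ Icc (-M) M, ∀ v' ∈ Icc (-M) M,
      |g r v - g r v'| ≤ D * |v - v'| := by
  have hopen : IsOpen (Ioi R ×ˢ (univ : Set ℝ)) := isOpen_Ioi.prod isOpen_univ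
  have hsub : Icc a b ×ˢ Icc (-M) M ⊆ Ioi R ×ˢ (univ : Set ℝ) :=
    prod_mono (fun x hx => ha.trans_le hx.1) (subset_univ _)
  obtain ⟨D, hD⟩ := (isCompact_Icc.prod isCompact_Icc).exists_bound_of_continuousOn
    ((hg.continuousOn_fderiv_of_isOpen hopen le_rfl).mono hsub)
  refine ⟨max D 0, le_max_right _ _, fun r hr v hv v' hv' => ?_⟩
  refine Convex.norm_image_sub_le_of_norm_hasDerivWithin_le (s := Icc (-M) M)
    (f' := fun v => fderiv ℝ (fun q : ℝ × ℝ => g q.1 q.2) (r, v) (0, 1))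
    (fun x hx => ?_) (fun x hx => ?_) (convex_Icc _ _) hv' hv
  · have h1 : HasFDerivAt (fun q : ℝ × ℝ => g q.1 q.2) _ (r, x) :=
      ((hg.differentiableOn one_ne_zero).differentiableAt
        (hopen.mem_nhds (hsub ⟨hr, hx⟩))).hasFDerivAt
    exact (h1.comp_hasDerivAt x ((hasDerivAt_const x r).prodMk (hasDerivAt_id x))).hasDerivWithinAt
  · refine (ContinuousLinearMap.le_opNorm _ _).trans ?_
    have h2 : ‖((0 : ℝ), (1 : ℝ))‖ = 1 := by simp [Prod.norm_def]
    rw [h2, mul_one]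
    exact (hD (r, x) ⟨hr, hx⟩).trans (le_max_left _ _)

lemma monotoneOn_of_deriv_snd_nonneg {R : ℝ} {g : ℝ → ℝ → ℝ}
    (hg : ContDiffOn ℝ 1 (fun q : ℝ × ℝ => g q.1 q.2) (Ioi R ×ˢ univ)) {r : ℝ} (hr : R < r)
    (hg' : ∀ v, 0 ≤ v → 0 ≤ deriv (g r) v) : MonotoneOn (g r) (Ici 0) := by
  have hopen : IsOpen (Ioi R ×ˢ (univ : Set ℝ)) := isOpen_Ioi.prod isOpen_univ
  have hd : Differentiable ℝ (g r) := fun x =>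
    DifferentiableAt.comp x (g := fun q : ℝ × ℝ => g q.1 q.2) (f := fun y => (r, y))
      ((hg.differentiableOn one_ne_zero).differentiableAt
        (hopen.mem_nhds ⟨hr, mem_univ _⟩)) (by fun_prop)
  exact monotoneOn_of_deriv_nonneg (convex_Ici 0) hd.continuous.continuousOn
    hd.differentiableOn fun x hx => hg' x (interior_subset hx)

/-- The quantity `t² sup 1 / r²` over a backward triangle is small where `r` is large compared
with `t`. -/
lemma integral_potential_le_one {c β : ℝ} (hc : 0 ≤ c) (hβ : 2 + c ≤ β) {q : ℝ × ℝ}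
    (hq0 : 0 ≤ q.2) (hq : β * q.2 < q.1) :
    1 / 2 * ∫ x in backwardTriangle q, c / x.1 ^ 2 ≤ 1 := by
  have hζ : 0 < q.1 - q.2 := by nlinarith
  have hpos : ∀ x ∈ closedTriangle q, q.1 - q.2 ≤ x.1 := fun x hx => by
    linarith [hx.1, hx.2.2]
  have hcont : ContinuousOn (fun x : ℝ × ℝ => c / x.1 ^ 2) (closedTriangle q) :=
    continuousOn_const.div (continuousOn_fst.pow 2)
      fun x hx => (pow_pos (hζ.trans_le (hpos x hx)) 2).ne'
  have h1 : ∫ x in backwardTriangle q, c / x.1 ^ 2 ≤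
      ∫ _x in backwardTriangle q, c / (q.1 - q.2) ^ 2 * 1 := by
    refine setIntegral_mono_on (integrableOn_backwardTriangle hcont)
      (integrableOn_backwardTriangle continuousOn_const) (measurableSet_backwardTriangle q)
      fun x hx => ?_
    rw [mul_one]
    have := hpos x (backwardTriangle_subset_closedTriangle q hx)
    gcongr
  have h2 := h1.trans (setIntegral_backwardTriangle_le_prod (p := q)
    (f := fun _ => c / (q.1 - q.2) ^ 2) (g := fun _ => 1) continuous_const continuous_const
    (fun _ => by positivity) (fun _ => zero_le_one))
  have h3 : ∫ _x in Icc (q.1 - q.2) (q.1 + q.2), c / (q.1 - q.2) ^ 2 =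
      2 * q.2 * (c / (q.1 - q.2) ^ 2) := by
    rw [setIntegral_const, Real.volume_real_Icc_of_le (by linarith), smul_eq_mul]
    ring
  have h4 : ∫ _s in Icc 0 q.2, (1 : ℝ) = q.2 := by simp [hq0]
  rw [h3, h4] at h2
  have h5 : c * q.2 ^ 2 ≤ (q.1 - q.2) ^ 2 := by
    have h6 : (1 + c) * q.2 ≤ q.1 - q.2 := by nlinarith
    have h7 : ((1 + c) * q.2) ^ 2 ≤ (q.1 - q.2) ^ 2 := by gcongr
    nlinarith [mul_nonneg (show 0 ≤ 1 + c + c ^ 2 by positivity) (sq_nonneg q.2)]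
  have h6 : q.2 * (c / (q.1 - q.2) ^ 2) * q.2 ≤ 1 := by
    rw [mul_div_assoc', div_mul_eq_mul_div, div_le_one (by positivity)]
    linarith
  linarith

/-- Let `u₁`, `u₂` satisfy d'Alembert's formula with data `ψ₁ ≥ ψ₂`. If `u₂ ≥ 0` then `u₁ ≥ u₂`
in every backward triangle whose apex lies in the region `r > max (β t) (t + R)`. -/
theorem le_of_dAlembertFormula {R β k : ℝ} (hR : 0 < R) (hβ : 2 + |k * (k - 1)| ≤ β)
    {g : ℝ → ℝ → ℝ} (hg : ContDiffOn ℝ 1 (fun q : ℝ × ℝ => g q.1 q.2) (Ioi R ×ˢ univ))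
    (hg' : ∀ r v : ℝ, R < r → 0 ≤ v → 0 ≤ deriv (g r) v)
    {ψ₁ ψ₂ : ℝ → ℝ} (hψ₁ : ContinuousOn ψ₁ (Ioi R)) (hψ₂ : ContinuousOn ψ₂ (Ioi R))
    (hψ : ∀ r, R < r → ψ₂ r ≤ ψ₁ r) {p : ℝ × ℝ} (hp : max (β * p.2) (p.2 + R) < p.1)
    {u₁ u₂ : ℝ × ℝ → ℝ} (hu₁ : ContinuousOn u₁ (closedTriangle p))
    (hu₂ : ContinuousOn u₂ (closedTriangle p))
    (h₁ : ∀ q ∈ closedTriangle p, DAlembertFormula k g ψ₁ u₁ q)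
    (h₂ : ∀ q ∈ closedTriangle p, DAlembertFormula k g ψ₂ u₂ q)
    (h0 : ∀ q ∈ closedTriangle p, 0 ≤ u₂ q) :
    ∀ q ∈ closedTriangle p, u₂ q ≤ u₁ q := by
  set c := k * (k - 1) with hc
  have hβ1 : 1 < β := by linarith [abs_nonneg c]
  have hreg : ∀ q ∈ closedTriangle p, max (β * q.2) (q.2 + R) < q.1 := fun q hq =>
    region_of_backward hβ1 hp (snd_le_of_mem_closedTriangle hq) hq.2.2
  have hpR : R < p.1 - p.2 := by linarith [(max_lt_iff.1 hp).2]
  have hKR : ∀ q ∈ closedTriangle p, R < q.1 := fun q hq => by linarith [hq.1, hq.2.2]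
  have hpos : ∀ q ∈ closedTriangle p, 0 < q.1 := fun q hq => hR.trans (hKR q hq)
  have hcpow : ContinuousOn (fun q : ℝ × ℝ => q.1 ^ k) (closedTriangle p) :=
    continuousOn_fst.rpow_const fun q hq => Or.inl (hpos q hq).ne'
  have hcinv : ∀ b : ℝ, ContinuousOn (fun q : ℝ × ℝ => b / q.1 ^ 2) (closedTriangle p) :=
    fun b => continuousOn_const.div (continuousOn_fst.pow 2)
      fun q hq => (pow_pos (hpos q hq) 2).ne'
  have hcg : ∀ {u : ℝ × ℝ → ℝ}, ContinuousOn u (closedTriangle p) →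
      ContinuousOn (fun q => q.1 ^ k * g q.1 (u q)) (closedTriangle p) := fun hu =>
    hcpow.mul (hg.continuousOn.comp (continuousOn_fst.prodMk hu) fun q hq => ⟨hKR q hq, mem_univ _⟩)
  have hcsrc : ∀ {u : ℝ × ℝ → ℝ}, ContinuousOn u (closedTriangle p) → ContinuousOn
      (fun q => q.1 ^ k * g q.1 (u q) - c / q.1 ^ 2 * (q.1 ^ k * u q)) (closedTriangle p) :=
    fun hu => (hcg hu).sub ((hcinv c).mul (hcpow.mul hu))
  have hIcc : Icc (p.1 - p.2) (p.1 + p.2) ⊆ Ioi R := fun x hx => hpR.trans_le hx.1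
  have hiψ : ∀ {ψ : ℝ → ℝ}, ContinuousOn ψ (Ioi R) →
      IntegrableOn (fun r => r ^ k * ψ r) (Ioo (p.1 - p.2) (p.1 + p.2)) := fun hψ =>
    (((continuousOn_id.rpow_const fun x hx => Or.inl (hR.trans (hIcc hx)).ne').mul
      (hψ.mono hIcc)).integrableOn_compact isCompact_Icc).mono_set Ioo_subset_Icc_self
  have hcw : ContinuousOn (fun q => q.1 ^ k * (u₁ q - u₂ q)) (closedTriangle p) :=
    hcpow.mul (hu₁.sub hu₂)
  have hcpt := isCompact_closedTriangle p
  obtain ⟨M₁, hM₁⟩ := hcpt.exists_bound_of_continuousOn hu₁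
  obtain ⟨M₂, hM₂⟩ := hcpt.exists_bound_of_continuousOn hu₂
  obtain ⟨D, hD0, hD⟩ := exists_lipschitz_bound hg (b := p.1 + p.2) hpR (max M₁ M₂)
  have hsource : ∀ q ∈ closedTriangle p, -(D * max (-(q.1 ^ k * (u₁ q - u₂ q))) 0) ≤
      q.1 ^ k * g q.1 (u₁ q) - q.1 ^ k * g q.1 (u₂ q) := by
    intro q hq
    have hqk : 0 < q.1 ^ k := Real.rpow_pos_of_pos (hpos q hq) k
    rw [← mul_sub]
    rcases le_total (u₂ q) (u₁ q) with h | h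
    · have h1 := monotoneOn_of_deriv_snd_nonneg hg (hKR q hq) (fun v => hg' q.1 v (hKR q hq))
        (h0 q hq) ((h0 q hq).trans h) h
      have h2 : 0 ≤ D * max (-(q.1 ^ k * (u₁ q - u₂ q))) 0 :=
        mul_nonneg hD0 (le_max_right _ _)
      have h3 := mul_nonneg hqk.le (sub_nonneg.2 h1)
      linarith
    · have h1 := hD q.1 (closedTriangle_subset_prod p hq).1 (u₁ q)
        (abs_le.1 ((hM₁ q hq).trans (le_max_left _ _))) (u₂ q)
        (abs_le.1 ((hM₂ q hq).trans (le_max_right _ _)))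
      rw [abs_of_nonpos (sub_nonpos.2 h)] at h1
      have h2 := mul_le_mul_of_nonneg_left ((neg_abs_le _).trans' (neg_le_neg h1)) hqk.le
      have h3 := mul_le_mul_of_nonneg_left
        (le_max_left (-(q.1 ^ k * (u₁ q - u₂ q))) 0) hD0
      linarith
  -- The positive part of the potential stays, the negative part is moved into the source.
  have hsum : max c 0 + min c 0 = c := by rw [max_add_min, add_zero]
  have key := nonneg_of_integral_equation (p₀ := p) (w := fun q => q.1 ^ k * (u₁ q - u₂ q))
    (V := fun q => max c 0 / q.1 ^ 2)
    (F := fun q => q.1 ^ k * g q.1 (u₁ q) - q.1 ^ k * g q.1 (u₂ q) -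
      min c 0 / q.1 ^ 2 * (q.1 ^ k * (u₁ q - u₂ q)))
    (Ψ := fun r => r ^ k * ψ₁ r - r ^ k * ψ₂ r) (C := D + |c| / R ^ 2) hcw (hcinv _)
    (((hcg hu₁).sub (hcg hu₂)).sub ((hcinv _).mul hcw)) ((hiψ hψ₁).sub (hiψ hψ₂))
    (fun r hr => ?_) (fun q hq => by positivity)
    (fun q hq => integral_potential_le_one (le_max_right _ _) (β := β)
      (hβ.trans' (by gcongr; exact max_le (le_abs_self c) (abs_nonneg c))) hq.1
      (max_lt_iff.1 (hreg q hq)).1) (by positivity) (fun q hq => ?_) (fun q hq => ?_)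
  · intro q hq
    have h := key q hq
    have := (mul_nonneg_iff_of_pos_left (Real.rpow_pos_of_pos (hpos q hq) k)).1 h
    linarith
  · have hrR := hIcc (Ioo_subset_Icc_self hr)
    rw [← mul_sub]
    exact mul_nonneg (Real.rpow_nonneg (hR.trans hrR).le k) (sub_nonneg.2 (hψ r hrR))
  · have h1 := hsource q hq
    set w := q.1 ^ k * (u₁ q - u₂ q)
    have h2 : -(min c 0) / q.1 ^ 2 ≤ |c| / R ^ 2 := by
      have h3 : -(min c 0) ≤ |c| := by
        rw [neg_le]
        exact le_min (neg_abs_le c) (by simp)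
      have := hKR q hq
      gcongr
    have h3 : 0 ≤ -(min c 0) / q.1 ^ 2 :=
      div_nonneg (neg_nonneg.2 (min_le_right _ _)) (sq_nonneg _)
    have h4 : -(min c 0) / q.1 ^ 2 * -w ≤ |c| / R ^ 2 * max (-w) 0 :=
      (mul_le_mul_of_nonneg_left (le_max_left _ _) h3).trans
        (mul_le_mul_of_nonneg_right h2 (le_max_right _ _))
    have h5 : -(min c 0) / q.1 ^ 2 * -w = min c 0 / q.1 ^ 2 * w := by ring
    linarith
  · have e1 := h₁ q hq
    have e2 := h₂ q hq
    unfold DAlembertFormula at e1 e2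
    have hI : Ioo (q.1 - q.2) (q.1 + q.2) ⊆ Ioo (p.1 - p.2) (p.1 + p.2) :=
      Ioo_subset_Ioo hq.2.2 hq.2.1
    have hi : ∀ {u : ℝ × ℝ → ℝ}, ContinuousOn u (closedTriangle p) → IntegrableOn
        (fun q => q.1 ^ k * g q.1 (u q) - c / q.1 ^ 2 * (q.1 ^ k * u q)) (backwardTriangle q) :=
      fun hu => integrableOn_backwardTriangle ((hcsrc hu).mono (closedTriangle_mono hq))
    have e3 := integral_sub ((hiψ hψ₁).mono_set hI) ((hiψ hψ₂).mono_set hI)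
    have e4 := integral_sub (hi hu₁) (hi hu₂)
    have e5 : ∫ x in backwardTriangle q, (x.1 ^ k * g x.1 (u₁ x) - x.1 ^ k * g x.1 (u₂ x) -
        min c 0 / x.1 ^ 2 * (x.1 ^ k * (u₁ x - u₂ x)) -
        max c 0 / x.1 ^ 2 * (x.1 ^ k * (u₁ x - u₂ x))) =
      ∫ x in backwardTriangle q, ((x.1 ^ k * g x.1 (u₁ x) - c / x.1 ^ 2 * (x.1 ^ k * u₁ x)) -
        (x.1 ^ k * g x.1 (u₂ x) - c / x.1 ^ 2 * (x.1 ^ k * u₂ x))) := by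
      refine integral_congr_ae (.of_forall fun x => ?_)
      simp only
      linear_combination (x.1 ^ k * (u₂ x - u₁ x) / x.1 ^ 2) * hsum
    rw [e3, e5, e4]
    linarith

lemma dAlembertFormula_zero (k : ℝ) {R : ℝ} {g : ℝ → ℝ → ℝ} (hg : ∀ r, R < r → g r 0 = 0)
    {p : ℝ × ℝ} (hp : p.2 + R < p.1) : DAlembertFormula k g (fun _ => 0) (fun _ => 0) p := by
  have h : ∫ q in backwardTriangle p, q.1 ^ k * g q.1 0 = 0 := by
    refine setIntegral_eq_zero_of_forall_eq_zero fun q hq => ?_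
    rw [hg q.1 (by linarith [hq.1, hq.2.2]), mul_zero]
  simp [DAlembertFormula, h]

end RadialWave

theorem lemma5p4 (n : ℕ) (hn : 1 ≤ n) :
    ∃ β : ℝ, 1 < β ∧ RadialWave.PositivityConstant n β ∧
      ∀ (R : ℝ), 0 < R →
      ∀ (g : ℝ → ℝ → ℝ),
        ContDiffOn ℝ 1 (fun q : ℝ × ℝ => g q.1 q.2) (Set.Ioi R ×ˢ Set.univ) →
        (∀ r : ℝ, R < r → g r 0 = 0) →
        (∀ r v : ℝ, R < r → 0 ≤ v → 0 ≤ deriv (g r) v) →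
      ∀ (ψ₁ ψ₂ : ℝ → ℝ),
        ContinuousOn ψ₁ (Set.Ioi R) → ContinuousOn ψ₂ (Set.Ioi R) →
        (∀ r : ℝ, R < r → 0 ≤ ψ₂ r ∧ ψ₂ r ≤ ψ₁ r) →
      ∀ (T₁ T₂ : EReal) (u₁ u₂ : ℝ × ℝ → ℝ),
        RadialWave.IsSolution n R T₁ g ψ₁ u₁ →
        RadialWave.IsSolution n R T₂ g ψ₂ u₂ →
      ∀ r t : ℝ, 0 ≤ t → (t : EReal) < T₁ → (t : EReal) < T₂ → max (β * t) (t + R) < r →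
        0 ≤ u₂ (r, t) ∧ u₂ (r, t) ≤ u₁ (r, t) := by
  open RadialWave in
  obtain ⟨β₀, hβ₀, hpos⟩ := exists_positivityConstant n
  obtain ⟨k, hk⟩ : ∃ k : ℝ, k = ((n : ℝ) - 1) / 2 := ⟨_, rfl⟩
  have hβ : 2 + |k * (k - 1)| ≤ max β₀ (2 + |k * (k - 1)|) := le_max_right _ _
  refine ⟨max β₀ (2 + |k * (k - 1)|), by linarith [abs_nonneg (k * (k - 1))],
    hpos _ (le_max_left _ _), ?_⟩
  generalize max β₀ (2 + |k * (k - 1)|) = β at hβ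
  intro R hR g hg hg0 hg' ψ₁ ψ₂ hψ₁ hψ₂ hψ T₁ T₂ u₁ u₂ hu₁ hu₂ r t ht hT₁ hT₂ hrt
  have hR' : t + R < r := (max_lt_iff.1 hrt).2
  have hK : (r, t) ∈ closedTriangle (r, t) := ⟨ht, le_rfl, le_rfl⟩
  have hK₁ : closedTriangle (r, t) ⊆ Theta R T₁ := closedTriangle_subset_Theta hR' hT₁
  have hK₂ : closedTriangle (r, t) ⊆ Theta R T₂ := closedTriangle_subset_Theta hR' hT₂
  have hd₁ : ∀ q ∈ closedTriangle (r, t), DAlembertFormula k g ψ₁ u₁ q := fun q hq =>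
    hu₁.dAlembert hn hR hg.continuousOn hψ₁ hk hq.1 (hK₁ hq).1 (hK₁ hq).2.2
  have hd₂ : ∀ q ∈ closedTriangle (r, t), DAlembertFormula k g ψ₂ u₂ q := fun q hq =>
    hu₂.dAlembert hn hR hg.continuousOn hψ₂ hk hq.1 (hK₂ hq).1 (hK₂ hq).2.2
  have hc₁ := hu₁.continuousOn.mono hK₁
  have hc₂ := hu₂.continuousOn.mono hK₂
  have h0 : ∀ q ∈ closedTriangle (r, t), 0 ≤ u₂ q :=
    le_of_dAlembertFormula hR hβ hg hg' hψ₂ continuousOn_const (fun x hx => (hψ x hx).1) hrt hc₂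
      continuousOn_const hd₂ (fun q hq => dAlembertFormula_zero k hg0 (hK₁ hq).1) fun _ _ => le_rfl
  exact ⟨h0 _ hK, le_of_dAlembertFormula hR hβ hg hg' hψ₁ hψ₂ (fun x hx => (hψ x hx).2) hrt hc₁ hc₂
    hd₁ hd₂ h0 _ hK⟩
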